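/- **Theorem.** For a partition $\lambda=(\lambda_1\ge\lambda_2\ge\dots\ge\lambda_\ell)$ of $n\ge 0$ (positive parts, $\lambda_j:=0$ for $j>\ell$) let $\ell(\lambda)=\ell$ be its number of parts, $|\lambda|_a=\sum_{j=1}^{\ell}(-1)^{j-1}\lambda_j$ its alternating sum, $\ell_o(\lambda)$ the number of its odd parts (with multiplicity), and $n_o(\lambda)$ the number of distinct part sizes that occur in $\lambda$ with odd multiplicity. Let $\mathcal O(n)$ be the set of partitions of $n$ into odd parts, $\mathcal D(n)$ the set of partitions of $n$ into distinct parts, and $\mathcal S(n)$ the set of splitting partitions of $n$, that is, of those $\nu\in\mathcal D(n)$ such that $\nu_{2j-1}-\nu_{2j}\in\{1,2\}$ and $\nu_{2j-1}+\nu_{2j}\not\equiv 2\pmod 4$ whenever $0<2j\le \ell(\nu)+1$. *Bressoud's map.* Let $\beta$ be a partition with odd and distinct parts. Break it into its maximal runs of consecutive odd numbers. In each run pair off successive terms from the largest to the smallest; if the run has an odd number of terms, replace its smallest term $x$ by the pair $(\frac{x+1}{2},\frac{x-1}{2})$. Concatenate these pairs in order. As long as there are neighbouring pairs $(a+1,a\mid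 2b+1,2b-1)$ with $a\ge 2$, $b\ge 1$ and $a\le 2b+1$, perform a *pair interchange*: replace them by $(2b+3,2b+1\mid a-1,a-2)$. When no pair interchange is possible, drop any entry $0$; the resulting sequence is the image of $\beta$. *Insertion.* Let $\gamma$ be a sequence of pairs $(\gamma_1,\gamma_2\mid\gamma_3,\gamma_4\mid\cdots)$. To insert two copies of the odd number $2a-1$ into $\gamma$, put the pair $(2a,2a-2)$ in front of $\gamma$ and move it to the right as follows. Suppose the moving pair is $(2c+2,2c)$ and the next pair is $(z,w)$. If $c\ge1$ and $2c>z$, stop. If $c\ge 1$ and $2c\le z$, replace $(2c+2,2c\mid z,w)$ by $(z+2,w+2\mid 2c,2c-2)$ and continue with the moving pair $(2c,2c-2)$. If $c=0$, replace $(2,0\mid z,w)$ by $(z+2,w)$ and stop. If no next pair exists, stop. *The extended map.* Write $\lambda\in\mathcal O(n)$ uniquely as $\lambda=\alpha^2\circ\beta$, meaning that the parts of $\lambda$ are those of $\beta$ together with two copies of each part of $\alpha$ (with multiplicity), where $\beta$ has distinct parts. Start with the image of $\beta$ under Bressoud's map, cut into pairs of successive parts (with a final $0$ if the number of parts is odd),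 and insert two copies of $\alpha_1$, then of $\alpha_2$, and so on, where $\alpha_1\ge\alpha_2\ge\cdots$. Drop any entry $0$; the resulting sequence is the image $\mu$ of $\lambda$. Then for every $n\ge 0$: 1. Bressoud's map is well defined on $\mathcal O(n)\cap\mathcal D(n)$ (the result does not depend on the order of the pair interchanges) and is a bijection $\mathcal O(n)\cap\mathcal D(n)\to\mathcal S(n)$. 2. The extended map is well defined and is a bijection $\mathcal O(n)\to\mathcal D(n)$, $\lambda\mapsto\mu$. 3. The extended map agrees with Bressoud's map on $\mathcal O(n)\cap\mathcal D(n)$. 4. $|\mu|_a=\ell(\lambda)$ and $\ell_o(\mu)=n_o(\lambda)$ for every $\lambda\in\mathcal O(n)$ with image $\mu$. -/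

import Mathlib

namespace OddDistinct

/-- The parts of a partition (given as a multiset) as a non-increasing sequence. -/
def desc (s : Multiset ℕ) : List ℕ := s.sort (· ≥ ·)

/-- `part p j` is the `j`-th largest part `p_j` (for `j ≥ 1`), equal to `0` beyond the length. -/
def part {n : ℕ} (p : n.Partition) (j : ℕ) : ℕ := (desc p.parts).getD (j - 1) 0

/-- The number `ℓ(p)` of parts. -/
def len {n : ℕ} (p : n.Partition) : ℕ := Multiset.card p.parts

/-- The alternating sum `p_1 - p_2 + p_3 - ⋯`. -/
def altSum {n : ℕ} (p : n.Partition) : ℤ :=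
  ∑ j ∈ Finset.Icc 1 (len p), (-1 : ℤ) ^ (j - 1) * (part p j : ℤ)

/-- The number `ℓ_o(p)` of odd parts, counted with multiplicity. -/
def numOddParts {n : ℕ} (p : n.Partition) : ℕ := Multiset.card (p.parts.filter (fun i => Odd i))

/-- The number `n_o(p)` of distinct part sizes that occur with odd multiplicity. -/
def numOddMult {n : ℕ} (p : n.Partition) : ℕ :=
  (p.parts.toFinset.filter (fun i => Odd (p.parts.count i))).card

/-- The splitting partitions of `n`; they have distinct parts. -/
def splitting (n : ℕ) : Set n.Partition :=
  {p | p ∈ Nat.Partition.distincts n ∧ ∀ j : ℕ, 0 < 2 * j → 2 * j ≤ len p + 1 →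
    (part p (2 * j - 1) = part p (2 * j) + 1 ∨ part p (2 * j - 1) = part p (2 * j) + 2) ∧
    (part p (2 * j - 1) + part p (2 * j)) % 4 ≠ 2}

/-- Cut a sequence into pairs of successive entries, completing the last pair by `0` if the
length is odd. -/
def toPairs : List ℕ → List (ℕ × ℕ)
  | [] => []
  | [x] => [(x, 0)]
  | x :: y :: l => (x, y) :: toPairs l

/-- Read a sequence of pairs as a composition; entries `0` are discarded. -/
def ofPairs (l : List (ℕ × ℕ)) : List ℕ :=
  (l.flatMap (fun q => [q.1, q.2])).filter (fun i => i ≠ 0)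

/-- The double of an odd part `x`. -/
def double (x : ℕ) : ℕ × ℕ := ((x + 1) / 2, (x - 1) / 2)

/-- Pairing and doubling, for a strictly decreasing sequence of odd numbers: within each run of
consecutive odd numbers, successive terms are paired off from the largest to the smallest, and if
a run has an odd number of terms then its smallest term is replaced by its double. -/
def pairing : List ℕ → List (ℕ × ℕ)
  | [] => []
  | [x] => [double x]
  | x :: y :: l => if x = y + 2 then (x, y) :: pairing l else double x :: pairing (y :: l)

/-- One pair interchange: two neighbouring pairs `(a + 1, a ∣ 2b + 1, 2b - 1)` with `a ≤ 2b + 1`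
are replaced by `(2b + 3, 2b + 1 ∣ a - 1, a - 2)`. -/
inductive PairInterchange : List (ℕ × ℕ) → List (ℕ × ℕ) → Prop
  | swap (u v : List (ℕ × ℕ)) (a b : ℕ) (ha : 2 ≤ a) (hb : 1 ≤ b) (hab : a ≤ 2 * b + 1) :
      PairInterchange (u ++ (a + 1, a) :: (2 * b + 1, 2 * b - 1) :: v)
        (u ++ (2 * b + 3, 2 * b + 1) :: (a - 1, a - 2) :: v)

/-- `BressoudMap β μ`: starting with the paired composition of `β`, some sequence of pair
interchanges, applied until no further one is possible, ends in the composition whose entries, in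
this order, are the parts of the partition `μ` in non-increasing order. -/
def BressoudMap (β μ : Multiset ℕ) : Prop :=
  ∃ l : List (ℕ × ℕ), Relation.ReflTransGen PairInterchange (pairing (desc β)) l ∧
    (∀ l', ¬ PairInterchange l l') ∧ ofPairs l = desc μ

/-- Move the pair `(2c + 2, 2c)`, placed in front of the given pairs, to the right. If
`2c` exceeds the next entry `z` then stop. Otherwise interchange with the next pair `(z, w)`, which
becomes `(z + 2, w + 2)`, while the moving pair becomes `(2c, 2c - 2)`. Once the moving pair is
`(2, 0)`, it is absorbed by adding `2` to the next entry (which is `0` if no pairs remain). -/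
def insertAux : ℕ → List (ℕ × ℕ) → List (ℕ × ℕ)
  | 0, [] => [(2, 0)]
  | 0, (z, w) :: l => (z + 2, w) :: l
  | c + 1, [] => [(2 * (c + 1) + 2, 2 * (c + 1))]
  | c + 1, (z, w) :: l =>
      if z < 2 * (c + 1) then (2 * (c + 1) + 2, 2 * (c + 1)) :: (z, w) :: l
      else (z + 2, w + 2) :: insertAux c l

/-- Insertion into `γ` of two copies of the odd part `k = 2a - 1`, represented by the
pair `(2a, 2a - 2)`. -/
def insertPair (γ : List (ℕ × ℕ)) (k : ℕ) : List (ℕ × ℕ) := insertAux ((k - 1) / 2) γ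

/-- `ExtendedMap p μ`: write `p = α² ∘ β` with `β` having distinct parts, let `ν` be the image of
`β` under Bressoud's map, and insert the pairs `α_1², α_2², …` (with `α_1 ≥ α_2 ≥ ⋯`)
successively into `ν`. The result is the sequence of parts of `μ` in non-increasing order. -/
def ExtendedMap (p μ : Multiset ℕ) : Prop :=
  ∃ α β ν : Multiset ℕ, p = α + α + β ∧ β.Nodup ∧ BressoudMap β ν ∧
    ofPairs ((desc α).foldl insertPair (toPairs (desc ν))) = desc μ

end OddDistinct

/-! Bressoud's map is controlled by two invariants. A sequence of doubles and of pairs of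
consecutive odd numbers is coded by blocks `single a` and `couple b`. Give each single the value a
plus twice the number of couples before it, and each couple the value b plus the number of singles
before it. A pair interchange changes neither list of values (`Interchange.singles_eq`,
`Interchange.couples_eq`). Paired odd distinct partitions are the `Adj 1` chains; strictly
decreasing block sequences are the `Adj 2` chains. For either order, a chain is determined by its
invariants (`eq_of_singles_couples`), and the same pairs (A, B) occur: both lists have gaps at least
2, entries of A are at least 2|B|, and entries of B are at least |A| (`exists_singles_couples`).
Irreducible sequences reached from an `Adj 1` chain are `Adj 2` chains (`normal_form_iff`), so the
order of interchanges is irrelevant and the map is bijective. Insertion is inverted from right to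
left. `Inserted` records, for each pair of the result, whether it is an old pair or a newly settled
one, and how many moving pairs passed it and were absorbed by it. After the contribution of the
passing pairs is subtracted, parities decide which case holds (`Inserted.unique`,
`exists_of_decreasing`). The statistics follow because an interchange preserves sum, alternating sum
and number of odd entries, while inserting two copies of 2c + 1 adds 4c + 2, 2 and 0 to them. -/

namespace OddDistinct

/-! ### Blocks, their orders and the two invariants -/

/-- The two kinds of pairs of a splitting partition: `single a` is the pair `(a + 1, a)`, the double
of `2a + 1`, and `couple b` is the pair `(2b + 3, 2b + 1)` of consecutive odd numbers. -/
inductive Block : Type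
  | single (a : ℕ) : Block
  | couple (b : ℕ) : Block

open Block

namespace Block

/-- The pair that a block stands for. -/
def toPair : Block → ℕ × ℕ
  | single a => (a + 1, a)
  | couple b => (2 * b + 3, 2 * b + 1)

/-- Which blocks may follow each other. For `k = 1` this describes the pairing of a strictly
decreasing sequence of odd numbers, for `k = 2` the sequences of pairs that are strictly
decreasing. -/
def Adj (k : ℕ) : Block → Block → Prop
  | single a, single a' => a' + 2 ≤ a
  | single a, couple b => k * b + k + 2 ≤ a
  | couple b, single a => a < k * b
  | couple b, couple b' => b' + 2 ≤ b

end Block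

/-- The values `a` of the blocks `single a`, each increased by twice the number of preceding
couples (`o` of them preceding the whole list). -/
def singles : ℕ → List Block → List ℕ
  | _, [] => []
  | o, single a :: l => (a + 2 * o) :: singles o l
  | o, couple _ :: l => singles (o + 1) l

/-- The values `b` of the blocks `couple b`, each increased by the number of preceding
singles (`i` of them preceding the whole list). -/
def couples : ℕ → List Block → List ℕ
  | _, [] => []
  | i, single _ :: l => couples (i + 1) l
  | i, couple b :: l => (b + i) :: couples i l

/-- Decreasing sequences with all differences at least two. -/
def Gapped (A : List ℕ) : Prop := A.Pairwise (fun x y => y + 2 ≤ x)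

lemma length_singles (l : List Block) : ∀ o o', (singles o l).length = (singles o' l).length := by
  induction l with
  | nil => simp [singles]
  | cons x l ih =>
    intro o o'
    cases x with
    | single a => simpa [singles] using ih o o'
    | couple b => simpa [singles] using ih (o + 1) (o' + 1)

lemma length_couples (l : List Block) : ∀ i i', (couples i l).length = (couples i' l).length := by
  induction l with
  | nil => simp [couples]
  | cons x l ih =>
    intro i i'
    cases x with
    | single a => simpa [couples] using ih (i + 1) (i' + 1)
    | couple b => simpa [couples] using ih i i'

section sorted

variable {k : ℕ}

/-- Induction along the chain: passing a couple increases the shift of later singles by 2, and the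
slack in `Adj k` absorbs this for both values of k. The bounds give the gaps, and show that the
invariants determine the kind of the first block. -/
lemma singles_lt_of_head (hk : k = 1 ∨ k = 2) (l : List Block) :
    ∀ (x : Block) (o : ℕ), (x :: l).IsChain (Adj k) → ∀ a' ∈ singles o l,
      match x with
      | single a => a' + 2 ≤ a + 2 * o
      | couple b => a' < k * b + 2 * o := by
  induction l with
  | nil => intro x o _ a' h; simp [singles] at h
  | cons y l ih =>
    intro x o h a' ha'
    rw [List.isChain_cons_cons] at h
    obtain ⟨hxy, hc⟩ := h
    rcases hk with rfl | rfl
    all_goals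
      rcases y with a₂ | b₂
      · have := ih _ o hc a'
        simp only [singles, List.mem_cons] at ha' this
        rcases x with a | b <;> simp only [Adj] at hxy ⊢ <;> rcases ha' with rfl | ha'
        all_goals first | omega | (have := this ha'; omega)
      · have := ih _ (o + 1) hc a'
        simp only [singles] at ha' this
        have := this ha'
        rcases x with a | b <;> simp only [Adj] at hxy ⊢ <;> omega

lemma couples_lt_of_head (hk : k = 1 ∨ k = 2) (l : List Block) :
    ∀ (x : Block) (i : ℕ), (x :: l).IsChain (Adj k) → ∀ b' ∈ couples i l,
      match x with
      | single a => k * b' + k + 2 ≤ a + k * i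
      | couple b => b' + 2 ≤ b + i := by
  induction l with
  | nil => intro x o _ a' h; simp [couples] at h
  | cons y l ih =>
    intro x i h b' hb'
    rw [List.isChain_cons_cons] at h
    obtain ⟨hxy, hc⟩ := h
    rcases hk with rfl | rfl
    all_goals
      rcases y with a₂ | b₂
      · have := ih _ (i + 1) hc b'
        simp only [couples] at hb' this
        have := this hb'
        rcases x with a | b <;> simp only [Adj] at hxy ⊢ <;> omega
      · have := ih _ i hc b'
        simp only [couples, List.mem_cons] at hb' this
        rcases x with a | b <;> simp only [Adj] at hxy ⊢ <;> rcases hb' with rfl | hb'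
        all_goals first | omega | (have := this hb'; omega)

/-- Sizes fall fast enough along a chain to limit how many blocks can follow. This is the source of
the lower bounds on the invariants. -/
lemma length_le_of_head (hk : k = 1 ∨ k = 2) (l : List Block) :
    ∀ x : Block, (x :: l).IsChain (Adj k) →
      match x with
      | single a => 2 * (singles 0 l).length ≤ a ∧ 2 * (couples 0 l).length ≤ a
      | couple b => 2 * (singles 0 l).length ≤ k * b + 1 ∧
          2 * (couples 0 l).length ≤ k * b + 1 := by
  induction l with
  | nil => intro x _; cases x <;> simp [singles, couples]
  | cons y l ih =>
    intro x h
    rw [List.isChain_cons_cons] at h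
    obtain ⟨hxy, hc⟩ := h
    have h1 := length_singles l (0 + 1) 0
    have h2 := length_couples l (0 + 1) 0
    have := ih _ hc
    rcases hk with rfl | rfl
    all_goals
      rcases y with a₂ | b₂ <;> rcases x with a | b <;>
        simp only [Adj, singles, couples, List.length_cons] at hxy this ⊢ <;> omega

lemma gapped_singles (hk : k = 1 ∨ k = 2) (l : List Block) :
    ∀ o, l.IsChain (Adj k) → Gapped (singles o l) := by
  induction l with
  | nil => intro o _; simp [singles, Gapped]
  | cons x l ih =>
    intro o h
    rcases x with a | b
    · exact List.pairwise_cons.2 ⟨singles_lt_of_head hk l _ o h, ih o h.tail⟩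
    · exact ih (o + 1) h.tail

lemma gapped_couples (hk : k = 1 ∨ k = 2) (l : List Block) :
    ∀ i, l.IsChain (Adj k) → Gapped (couples i l) := by
  induction l with
  | nil => intro o _; simp [couples, Gapped]
  | cons x l ih =>
    intro i h
    rcases x with a | b
    · exact ih (i + 1) h.tail
    · exact List.pairwise_cons.2 ⟨couples_lt_of_head hk l _ i h, ih i h.tail⟩

/-- Couples before a single contribute 2 each to its shift, and those after it number at most half
its size; so all couples are accounted for. -/
lemma le_of_mem_singles (hk : k = 1 ∨ k = 2) (l : List Block) :
    ∀ o i, l.IsChain (Adj k) → ∀ a ∈ singles o l, 2 * (o + (couples i l).length) ≤ a := by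
  induction l with
  | nil => intro o i _; simp [singles]
  | cons x l ih =>
    intro o i h a' ha'
    have hl := length_le_of_head hk l _ h
    have h2 := length_couples l (i + 1) 0
    rcases x with a | b
    · simp only [singles, couples, List.mem_cons] at ha' hl ⊢
      rcases ha' with rfl | ha'
      · omega
      · exact ih o (i + 1) h.tail _ ha'
    · have := ih (o + 1) i h.tail _ ha'
      simp only [couples, List.length_cons]
      omega

lemma le_of_mem_couples (hk : k = 1 ∨ k = 2) (l : List Block) :
    ∀ o i, l.IsChain (Adj k) → ∀ b ∈ couples i l, i + (singles o l).length ≤ b := by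
  induction l with
  | nil => intro o i _; simp [couples]
  | cons x l ih =>
    intro o i h b' hb'
    have hl := length_le_of_head hk l _ h
    have h2 := length_singles l (o + 1) 0
    rcases x with a | b
    · have := ih o (i + 1) h.tail _ hb'
      simp only [singles, List.length_cons]
      omega
    · simp only [singles, couples, List.mem_cons] at hb' hl ⊢
      rcases hb' with rfl | hb'
      · rcases hk with rfl | rfl <;> omega
      · exact ih (o + 1) i h.tail _ hb'

/-- A sorted list of blocks is determined by the two invariants. -/
lemma eq_of_singles_couples (hk : k = 1 ∨ k = 2) (l : List Block) :
    ∀ (l' : List Block) (o i : ℕ), l.IsChain (Adj k) → l'.IsChain (Adj k) →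
      singles o l = singles o l' → couples i l = couples i l' → l = l' := by
  -- The invariants decide the kind of the first block: a leading couple would force a < kb + 2, a
  -- leading single kb + 2 ≤ a.
  have key : ∀ (a b o i : ℕ) (t t' : List Block), (single a :: t).IsChain (Adj k) →
      (couple b :: t').IsChain (Adj k) → singles o (single a :: t) = singles o (couple b :: t') →
      couples i (single a :: t) = couples i (couple b :: t') → False := by
    intro a b o i t t' h h' hs hc
    have h1 := singles_lt_of_head hk t' _ (o + 1) h' (a + 2 * o)
      (by simp only [singles] at hs; simp [← hs])
    have h2 := couples_lt_of_head hk t _ (i + 1) h (b + i)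
      (by simp only [couples] at hc; simp [hc])
    simp only at h1 h2
    rcases hk with rfl | rfl <;> omega
  induction l with
  | nil =>
    intro l' o i _ _ hs hc
    rcases l' with _ | ⟨_ | _, t⟩
    · rfl
    · simp [singles] at hs
    · simp [couples] at hc
  | cons x t ih =>
    intro l' o i h h' hs hc
    rcases l' with _ | ⟨y, t'⟩
    · rcases x with _ | _
      · simp [singles] at hs
      · simp [couples] at hc
    rcases x with a | b <;> rcases y with a' | b'
    · simp only [singles, couples, List.cons.injEq] at hs hc
      rw [ih t' o (i + 1) h.tail h'.tail hs.2 hc, show a = a' by omega]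
    · exact (key _ _ _ _ _ _ h h' hs hc).elim
    · exact (key _ _ _ _ _ _ h' h hs.symm hc.symm).elim
    · simp only [singles, couples, List.cons.injEq] at hs hc
      rw [ih t' (o + 1) i h.tail h'.tail hs hc.2, show b = b' by omega]

/-- Every admissible value of the two invariants is attained by a sorted list of blocks. -/
lemma exists_singles_couples (N : ℕ) :
    ∀ (A B : List ℕ) (o i : ℕ), A.length + B.length = N → Gapped A → Gapped B →
      (∀ a ∈ A, 2 * (o + B.length) ≤ a) → (∀ b ∈ B, i + A.length ≤ b) →
      ∃ l : List Block, l.IsChain (Adj k) ∧ singles o l = A ∧ couples i l = B := by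
  induction N with
  | zero =>
    intro A B o i hN _ _ _ _
    obtain ⟨hA, hB⟩ : A.length = 0 ∧ B.length = 0 := by omega
    rw [List.length_eq_zero_iff] at hA hB
    subst hA hB
    exact ⟨[], by simp, rfl, rfl⟩
  | succ N ih =>
    have takeSingle : ∀ (a : ℕ) (A B : List ℕ) (o i : ℕ), (a :: A).length + B.length = N + 1 →
        Gapped (a :: A) → Gapped B → (∀ a' ∈ a :: A, 2 * (o + B.length) ≤ a') →
        (∀ b ∈ B, i + (a :: A).length ≤ b) →
        (∀ b ∈ B.head?, k * (b - i - 1) + k + 2 ≤ a - 2 * o) →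
        ∃ l : List Block, l.IsChain (Adj k) ∧ singles o l = a :: A ∧ couples i l = B := by
      intro a A B o i hN hA hB hA' hB' hP
      obtain ⟨l, hl, hs, hc⟩ := ih A B o (i + 1) (by simp at hN; omega) hA.tail hB
        (fun a' ha' => hA' a' (by simp [ha']))
        (fun b hb => by have := hB' b hb; simp at this; omega)
      have ha := hA' a (by simp)
      refine ⟨single (a - 2 * o) :: l, ?_, ?_, ?_⟩
      · refine List.isChain_cons.2 ⟨?_, hl⟩
        intro y hy
        rcases l with _ | ⟨x, t⟩
        · simp at hy
        obtain rfl : x = y := by simpa using hy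
        rcases x with a₂ | b₂
        · simp only [singles] at hs
          have := List.rel_of_pairwise_cons hA (a' := a₂ + 2 * o) (by simp [← hs])
          simp only [Adj]
          omega
        · simp only [couples] at hc
          have := hP (b₂ + (i + 1)) (by simp [← hc])
          simp only [Adj]
          rwa [show b₂ + (i + 1) - i - 1 = b₂ by omega] at this
      · simp only [singles, hs, List.cons.injEq, and_true]
        omega
      · simp only [couples, hc]
    have takeCouple : ∀ (b : ℕ) (A B : List ℕ) (o i : ℕ), A.length + (b :: B).length = N + 1 →
        Gapped A → Gapped (b :: B) → (∀ a ∈ A, 2 * (o + (b :: B).length) ≤ a) →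
        (∀ b' ∈ b :: B, i + A.length ≤ b') →
        (∀ a ∈ A.head?, a - 2 * o < k * (b - i) + 2) →
        ∃ l : List Block, l.IsChain (Adj k) ∧ singles o l = A ∧ couples i l = b :: B := by
      intro b A B o i hN hA hB hA' hB' hP
      obtain ⟨l, hl, hs, hc⟩ := ih A B (o + 1) i (by simp at hN; omega) hA hB.tail
        (fun a ha => by have := hA' a ha; simp at this; omega)
        (fun b' hb' => hB' b' (by simp [hb']))
      have hb := hB' b (by simp)
      refine ⟨couple (b - i) :: l, ?_, ?_, ?_⟩
      · refine List.isChain_cons.2 ⟨?_, hl⟩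
        intro y hy
        rcases l with _ | ⟨x, t⟩
        · simp at hy
        obtain rfl : x = y := by simpa using hy
        rcases x with a₂ | b₂
        · simp only [singles] at hs
          have := hP (a₂ + 2 * (o + 1)) (by simp [← hs])
          simp only [Adj]
          omega
        · simp only [couples] at hc
          have := List.rel_of_pairwise_cons hB (a' := b₂ + i) (by simp [← hc])
          simp only [Adj]
          omega
      · simp only [singles, hs]
      · simp only [couples, hc, List.cons.injEq, and_true]
        omega
    intro A B o i hN hA hB hA' hB'
    rcases A with _ | ⟨a, A⟩
    · rcases B with _ | ⟨b, B⟩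
      · simp at hN
      · exact takeCouple b [] B o i hN hA hB hA' hB' (by simp)
    rcases B with _ | ⟨b, B⟩
    · exact takeSingle a A [] o i hN hA hB hA' hB' (by simp)
    -- This is the `Adj k` condition for the first single to precede the first couple, whose size is
    -- b - i - 1 once the single has been counted. Its negation is the condition for the opposite
    -- order.
    by_cases hP : k * (b - i - 1) + k + 2 ≤ a - 2 * o
    · exact takeSingle a A _ o i hN hA hB hA' hB' (by simpa using hP)
    · refine takeCouple b _ B o i hN hA hB hA' hB' ?_
      have := hB' b (by simp)
      simp only [List.length_cons] at this
      obtain ⟨c, hc⟩ : ∃ c, b - i = c + 1 := ⟨b - i - 1, by omega⟩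
      simp only [List.head?_cons, Option.mem_def, Option.some.injEq, forall_eq']
      rw [hc] at hP ⊢
      simp only [Nat.add_sub_cancel] at hP
      rw [Nat.mul_add]
      omega

end sorted

/-! ### Odd distinct parts as chains of blocks -/

/-- The sequence of odd parts that a sequence of blocks arises from. -/
def oddParts : List Block → List ℕ
  | [] => []
  | single a :: l => (2 * a + 1) :: oddParts l
  | couple b :: l => (2 * b + 3) :: (2 * b + 1) :: oddParts l

lemma odd_of_mem_oddParts (l : List Block) : ∀ x ∈ oddParts l, Odd x := by
  induction l with
  | nil => simp [oddParts]
  | cons x l ih =>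
    rcases x with a | b
    · simp only [oddParts, List.mem_cons, forall_eq_or_imp]
      exact ⟨⟨a, by ring⟩, ih⟩
    · simp only [oddParts, List.mem_cons, forall_eq_or_imp]
      exact ⟨⟨b + 1, by ring⟩, ⟨b, by ring⟩, ih⟩

lemma isChain_oddParts (l : List Block) (h : l.IsChain (Adj 1)) :
    (oddParts l).IsChain (· > ·) := by
  induction l with
  | nil => simp [oddParts]
  | cons x l ih =>
    have ih := ih h.tail
    rcases l with _ | ⟨y, l⟩
    · rcases x with a | b <;> simp [oddParts]
    rw [List.isChain_cons_cons] at h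
    rcases x with a | b <;> rcases y with a' | b' <;>
      simp only [oddParts, Adj, List.isChain_cons_cons] at ih h ⊢ <;>
      grind

/-- In an `Adj 1` chain the odd part of a single exceeds the next part by at least 4, so greedy
pairing never joins it to its successor and recovers the blocks. -/
lemma pairing_oddParts (l : List Block) (h : l.IsChain (Adj 1)) :
    pairing (oddParts l) = l.map toPair := by
  induction l with
  | nil => simp [oddParts, pairing]
  | cons x l ih =>
    have ih := ih h.tail
    rcases x with a | b
    · have hd : double (2 * a + 1) = toPair (single a) := by
        simp only [double, toPair, Prod.mk.injEq]; omega
      rcases l with _ | ⟨y, l⟩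
      · simp [oddParts, pairing, hd]
      rw [List.isChain_cons_cons] at h
      rcases y with a' | b' <;>
      · simp only [oddParts, Adj] at ih h ⊢
        rw [pairing, if_neg (by omega), ih, hd]
        rfl
    · simp only [oddParts]
      rw [pairing, if_pos (by omega), ih]
      rfl

lemma exists_oddParts (N : ℕ) : ∀ L : List ℕ, L.length = N → L.IsChain (· > ·) →
    (∀ x ∈ L, Odd x) → ∃ l : List Block, l.IsChain (Adj 1) ∧ oddParts l = L := by
  induction N using Nat.strong_induction_on with
  | _ N ih =>
    intro L hN hL hodd
    rcases L with _ | ⟨x, L⟩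
    · exact ⟨[], by simp, rfl⟩
    have head : ∀ (l : List Block) (y : ℕ) (L : List ℕ), oddParts l = y :: L → ∀ z ∈ l.head?,
        (∃ a, z = single a ∧ y = 2 * a + 1) ∨ (∃ b, z = couple b ∧ y = 2 * b + 3) := by
      intro l y L h z hz
      rcases l with _ | ⟨_ | _, l⟩ <;> simp_all [oddParts] <;> grind
    rcases L with _ | ⟨y, L⟩
    · obtain ⟨a, rfl⟩ := hodd x (by simp)
      exact ⟨[single a], by simp, rfl⟩
    simp only [List.mem_cons, forall_eq_or_imp] at hodd
    rw [List.isChain_cons_cons] at hL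
    simp only [List.length_cons] at hN
    by_cases hxy : x = y + 2
    · obtain ⟨l, hl, hl'⟩ := ih L.length (by omega) L rfl hL.2.tail hodd.2.2
      obtain ⟨b, rfl⟩ := hodd.2.1
      refine ⟨couple b :: l, List.isChain_cons.2 ⟨?_, hl⟩, by simp [oddParts, hl', hxy]⟩
      intro z hz
      rcases L with _ | ⟨u, L⟩
      · rcases l with _ | ⟨_ | _, l⟩ <;> simp_all [oddParts]
      have := (List.isChain_cons_cons.1 hL.2).1
      rcases head l _ _ hl' z hz with ⟨a, rfl, rfl⟩ | ⟨a, rfl, rfl⟩ <;> simp only [Adj] <;> omega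
    · obtain ⟨l, hl, hl'⟩ := ih (L.length + 1) (by omega) (y :: L) rfl hL.2 (by simpa using hodd.2)
      obtain ⟨a, rfl⟩ := hodd.1
      refine ⟨single a :: l, List.isChain_cons.2 ⟨?_, hl⟩, by simp [oddParts, hl']⟩
      intro z hz
      rcases head l _ _ hl' z hz with ⟨b, rfl, rfl⟩ | ⟨b, rfl, rfl⟩ <;> simp only [Adj] <;> omega

lemma toPair_injective : Function.Injective toPair := by
  intro x y h
  rcases x with a | b <;> rcases y with a' | b' <;> simp [toPair] at h ⊢ <;> omega

/-! ### Pair interchanges and normal forms -/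

/-- The pair interchange, on blocks. -/
inductive Interchange : List Block → List Block → Prop
  | swap (u v : List Block) (a b : ℕ) (hab : a ≤ 2 * b + 1) :
      Interchange (u ++ single (a + 2) :: couple b :: v) (u ++ couple (b + 1) :: single a :: v)

/-- The difference of the entries reveals the kind of a block, so every interchange of pairs lifts
to blocks. Shifting a by 2 and b by 1 removes the truncated subtractions. -/
lemma pairInterchange_map_iff (l : List Block) (L : List (ℕ × ℕ)) :
    PairInterchange (l.map toPair) L ↔ ∃ l', Interchange l l' ∧ L = l'.map toPair := by
  constructor
  · intro h
    generalize hM : l.map toPair = M at h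
    obtain ⟨u, v, a, b, ha, hb, hab⟩ := h
    obtain ⟨u', l₂, rfl, rfl, h₂⟩ := List.map_eq_append_iff.1 hM
    obtain ⟨x, l₃, rfl, hx, h₃⟩ := List.map_eq_cons_iff.1 h₂
    obtain ⟨y, v', rfl, hy, rfl⟩ := List.map_eq_cons_iff.1 h₃
    obtain ⟨a, rfl⟩ := Nat.exists_eq_add_of_le' ha
    obtain ⟨b, rfl⟩ := Nat.exists_eq_add_of_le' hb
    obtain rfl : x = single (a + 2) := toPair_injective hx
    obtain rfl : y = couple b := toPair_injective (by rw [hy]; simp [toPair]; omega)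
    refine ⟨_, .swap u' v' a b (by omega), ?_⟩
    simp [toPair]
  · rintro ⟨l', ⟨u, v, a, b, hab⟩, rfl⟩
    have := PairInterchange.swap (u.map toPair) (v.map toPair) (a + 2) (b + 1) (by omega)
      (by omega) (by omega)
    convert this using 1 <;> (simp [toPair]; try omega)

/-- The single loses 2 but gains a preceding couple, which counts 2. -/
lemma Interchange.singles_eq {l l' : List Block} (h : Interchange l l') (o : ℕ) :
    singles o l = singles o l' := by
  obtain ⟨u, v, a, b, hab⟩ := h
  induction u generalizing o with
  | nil => simp [singles]; ring
  | cons x u ih => rcases x with _ | _ <;> simp [singles, ih]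

/-- The couple gains 1 but loses a preceding single. -/
lemma Interchange.couples_eq {l l' : List Block} (h : Interchange l l') (i : ℕ) :
    couples i l = couples i l' := by
  obtain ⟨u, v, a, b, hab⟩ := h
  induction u generalizing i with
  | nil => simp [couples]; ring
  | cons x u ih => rcases x with _ | _ <;> simp [couples, ih]

/-- The part of the order condition that holds after every sequence of interchanges. -/
def WeakAdj : Block → Block → Prop
  | couple b, single a => a < 2 * b
  | _, _ => True

/-- The only newly constrained neighbours are `couple (b + 1)` and `single a`, and for them a < 2(b
+ 1) is the condition a ≤ 2b + 1 of the interchange. -/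
lemma Interchange.isChain {l l' : List Block} (h : Interchange l l') (hl : l.IsChain WeakAdj) :
    l'.IsChain WeakAdj := by
  obtain ⟨u, v, a, b, hab⟩ := h
  rw [List.isChain_append] at hl ⊢
  obtain ⟨hu, hv, huv⟩ := hl
  refine ⟨hu, ?_, ?_⟩
  · refine List.isChain_cons_cons.2 ⟨by simp only [WeakAdj]; omega, List.isChain_cons.2 ⟨?_, ?_⟩⟩
    · intro y _
      simp [WeakAdj]
    · exact hv.tail.tail
  · intro x _ y hy
    obtain rfl : couple (b + 1) = y := by simpa using hy
    cases x <;> simp [WeakAdj]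

lemma WeakAdj.of_adj {x y : Block} (h : Adj 1 x y) : WeakAdj x y := by
  rcases x with a | b <;> rcases y with a' | b' <;> simp only [WeakAdj, Adj] at h ⊢
  omega

/-- An irreducible sequence of blocks is strictly decreasing. -/
lemma isChain_of_irreducible (l : List Block) : ∀ o i, (∀ l', ¬ Interchange l l') →
    l.IsChain WeakAdj → Gapped (singles o l) → Gapped (couples i l) →
    (∀ a ∈ singles o l, 2 * (o + (couples i l).length) ≤ a) → l.IsChain (Adj 2) := by
  induction l with
  | nil => simp
  | cons x l ih =>
    intro o i hirr hw hs hc hb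
    have hirr' : ∀ l', ¬ Interchange l l' := by
      rintro _ ⟨u, v, a, b, hab⟩
      exact hirr _ (.swap (x :: u) v a b hab)
    refine List.isChain_cons.2 ⟨?_, ?_⟩
    · intro y hy
      rcases l with _ | ⟨z, t⟩
      · simp at hy
      obtain rfl : z = y := by simpa using hy
      rw [List.isChain_cons_cons] at hw
      rcases x with a | b <;> rcases z with a' | b'
      · have := List.rel_of_pairwise_cons hs (a' := a' + 2 * o) (by simp [singles])
        simp only [Adj]
        omega
      -- At least one couple follows, so the lower bound on the invariant gives a ≥ 2. Hence only
      -- the inequality on the sizes can block the interchange, and its failure is the `Adj 2`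
      -- condition.
      · have h2 := hb (a + 2 * o) (by simp [singles])
        simp only [couples, List.length_cons] at h2
        obtain ⟨a, rfl⟩ : ∃ c, a = c + 2 := ⟨a - 2, by omega⟩
        have h3 : ¬ a ≤ 2 * b' + 1 := fun h => hirr _ (.swap [] t a b' h)
        simp only [Adj]
        omega
      · exact hw.1
      · have := List.rel_of_pairwise_cons hc (a' := b' + i) (by simp [couples])
        simp only [Adj]
        omega
    · rcases x with a | b
      · exact ih o (i + 1) hirr' hw.tail hs.tail hc fun a' ha' => hb a' (by simp [singles, ha'])
      · refine ih (o + 1) i hirr' hw.tail hs hc.tail fun a' ha' => ?_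
        have := hb a' ha'
        simp only [couples, List.length_cons] at this
        omega

/-- The sum of the sizes of the singles, which drops with every interchange. -/
def singleSum : List Block → ℕ
  | [] => 0
  | single a :: l => a + singleSum l
  | couple _ :: l => singleSum l

lemma Interchange.singleSum_lt {l l' : List Block} (h : Interchange l l') :
    singleSum l' < singleSum l := by
  obtain ⟨u, v, a, b, hab⟩ := h
  induction u with
  | nil => simp [singleSum]
  | cons x u ih => rcases x with _ | _ <;> simp [singleSum, ih]

lemma exists_irreducible (N : ℕ) : ∀ l : List Block, singleSum l = N →
    ∃ l', Relation.ReflTransGen Interchange l l' ∧ ∀ l'', ¬ Interchange l' l'' := by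
  induction N using Nat.strong_induction_on with
  | _ N ih =>
    intro l hN
    by_cases h : ∃ l', Interchange l l'
    · obtain ⟨l', h⟩ := h
      obtain ⟨l'', h1, h2⟩ := ih _ (hN ▸ h.singleSum_lt) l' rfl
      exact ⟨l'', .head h h1, h2⟩
    · exact ⟨l, .refl, fun l'' h' => h ⟨l'', h'⟩⟩

lemma reflTransGen_map_iff (l : List Block) (L : List (ℕ × ℕ)) :
    Relation.ReflTransGen PairInterchange (l.map toPair) L ↔
      ∃ l', Relation.ReflTransGen Interchange l l' ∧ L = l'.map toPair := by
  constructor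
  · intro h
    induction h with
    | refl => exact ⟨l, .refl, rfl⟩
    | tail _ h ih =>
      obtain ⟨l', h', rfl⟩ := ih
      obtain ⟨l'', h'', rfl⟩ := (pairInterchange_map_iff l' _).1 h
      exact ⟨l'', h'.tail h'', rfl⟩
  · rintro ⟨l', h, rfl⟩
    induction h with
    | refl => exact .refl
    | tail _ h ih => exact ih.tail ((pairInterchange_map_iff _ _).2 ⟨_, h, rfl⟩)

/-- The normal forms of an initial sequence of blocks are the strictly decreasing sequences of
blocks with the same invariants. -/
lemma normal_form_iff {l : List Block} (hl : l.IsChain (Adj 1)) (l' : List Block) :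
    (Relation.ReflTransGen Interchange l l' ∧ ∀ l'', ¬ Interchange l' l'') ↔
      l'.IsChain (Adj 2) ∧ singles 0 l = singles 0 l' ∧ couples 0 l = couples 0 l' := by
  have inv : ∀ l', Relation.ReflTransGen Interchange l l' →
      l'.IsChain WeakAdj ∧ singles 0 l = singles 0 l' ∧ couples 0 l = couples 0 l' := by
    intro l' h
    induction h with
    | refl => exact ⟨hl.imp fun _ _ => WeakAdj.of_adj, rfl, rfl⟩
    | tail _ h ih =>
      exact ⟨h.isChain ih.1, ih.2.1.trans (h.singles_eq 0), ih.2.2.trans (h.couples_eq 0)⟩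
  have fwd : ∀ l', (Relation.ReflTransGen Interchange l l' ∧ ∀ l'', ¬ Interchange l' l'') →
      l'.IsChain (Adj 2) ∧ singles 0 l = singles 0 l' ∧ couples 0 l = couples 0 l' := by
    rintro l' ⟨h, hirr⟩
    obtain ⟨hw, hs, hc⟩ := inv l' h
    refine ⟨isChain_of_irreducible l' 0 0 hirr hw ?_ ?_ ?_, hs, hc⟩
    · exact hs ▸ gapped_singles (.inl rfl) l 0 hl
    · exact hc ▸ gapped_couples (.inl rfl) l 0 hl
    · exact hs ▸ hc ▸ le_of_mem_singles (.inl rfl) l 0 0 hl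
  -- No path to `l'` is constructed: any normal form of `l` is an `Adj 2` chain with the same
  -- invariants, hence equals `l'`.
  refine ⟨fwd l', fun ⟨h, hs, hc⟩ => ?_⟩
  obtain ⟨m, hm⟩ := exists_irreducible _ l rfl
  obtain ⟨h', hs', hc'⟩ := fwd m hm
  obtain rfl := eq_of_singles_couples (.inr rfl) m l' 0 0 h' h (hs'.symm.trans hs)
    (hc'.symm.trans hc)
  exact hm

/-- Every strictly decreasing sequence of blocks is a normal form. -/
lemma exists_initial {l' : List Block} (hl' : l'.IsChain (Adj 2)) :
    ∃ l : List Block, l.IsChain (Adj 1) ∧ singles 0 l = singles 0 l' ∧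
      couples 0 l = couples 0 l' :=
  exists_singles_couples _ _ _ 0 0 rfl (gapped_singles (.inr rfl) l' 0 hl')
    (gapped_couples (.inr rfl) l' 0 hl') (le_of_mem_singles (.inr rfl) l' 0 0 hl')
    (le_of_mem_couples (.inr rfl) l' 0 0 hl')

/-! ### Insertion of pairs and its inverse -/

/-- The pairs that occur in a splitting partition. -/
def IsSplit (q : ℕ × ℕ) : Prop := q.1 = q.2 + 1 ∨ (q.1 = q.2 + 2 ∧ Odd q.2)

/-- Sequences of pairs whose entries are strictly decreasing. -/
def Decreasing : List (ℕ × ℕ) → Prop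
  | [] => True
  | q :: l => q.2 < q.1 ∧ (∀ r ∈ l.head?, r.1 < q.2) ∧ Decreasing l

/-- `Inserted cs l L`: inserting the pairs `(2c + 2, 2c)`, for `c` in the decreasing sequence `cs`,
successively into the strictly decreasing sequence `l` of splitting pairs gives `L`. The sequence
`L` is built from the right to the left: its first pair either comes from the first pair of `l`,
or it is the first inserted pair. In both cases it is later passed by other moving
pairs, and then absorbs `m` of them. -/
inductive Inserted : List ℕ → List (ℕ × ℕ) → List (ℕ × ℕ) → Prop
  | nil : Inserted [] [] []
  | pass (cs : List ℕ) (l L : List (ℕ × ℕ)) (z w m : ℕ) (h : Inserted cs l L)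
      (hzw : IsSplit (z, w)) (hw : ∀ q ∈ l.head?, q.1 < w) (hz : ∀ c ∈ cs, 2 * (c + 1) ≤ z) :
      Inserted (cs.map (· + 1) ++ List.replicate m 0) ((z, w) :: l)
        ((z + 2 * cs.length + 2 * m, w + 2 * cs.length) :: L)
  | settle (cs : List ℕ) (l L : List (ℕ × ℕ)) (c m : ℕ) (h : Inserted cs l L)
      (hc : ∀ q ∈ l.head?, q.1 < 2 * c) (hcs : ∀ c' ∈ cs, c' + 1 ≤ c) :
      Inserted (c :: (cs.map (· + 1) ++ List.replicate m 0)) l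
        ((2 * c + 2 + 2 * cs.length + 2 * m, 2 * c + 2 * cs.length) :: L)

/-- Successive insertion of the pairs `(2c + 2, 2c)`. -/
def insertAll (l : List (ℕ × ℕ)) (cs : List ℕ) : List (ℕ × ℕ) :=
  cs.foldl (fun γ c => insertAux c γ) l

/-- The first pair only grows, so a moving pair that can pass it at its original size can still pass
it later. -/
lemma insertAll_pass (cs : List ℕ) : ∀ (z w : ℕ) (l : List (ℕ × ℕ)),
    (∀ c ∈ cs, 2 * (c + 1) ≤ z) → insertAll ((z, w) :: l) (cs.map (· + 1)) =
      (z + 2 * cs.length, w + 2 * cs.length) :: insertAll l cs := by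
  induction cs with
  | nil => intro z w l _; simp [insertAll]
  | cons c cs ih =>
    intro z w l h
    simp only [List.mem_cons, forall_eq_or_imp] at h
    have := ih (z + 2) (w + 2) (insertAux c l) (fun c hc => by have := h.2 c hc; omega)
    simp only [insertAll, List.map_cons, List.foldl_cons, List.length_cons] at this ⊢
    rw [insertAux, if_neg (by omega), this]
    simp only [List.cons.injEq, Prod.mk.injEq, and_true]
    omega

lemma insertAll_replicate (m : ℕ) : ∀ (z w : ℕ) (l : List (ℕ × ℕ)),
    insertAll ((z, w) :: l) (List.replicate m 0) = (z + 2 * m, w) :: l := by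
  induction m with
  | zero => simp [insertAll]
  | succ m ih =>
    intro z w l
    have := ih (z + 2) w l
    simp only [insertAll, List.replicate_succ, List.foldl_cons, insertAux] at this ⊢
    rw [this]
    simp only [List.cons.injEq, Prod.mk.injEq, and_true]
    omega

lemma insertAll_append (l : List (ℕ × ℕ)) (cs cs' : List ℕ) :
    insertAll l (cs ++ cs') = insertAll (insertAll l cs) cs' := by
  simp [insertAll]

namespace Inserted

variable {cs cs' : List ℕ} {l l' L : List (ℕ × ℕ)}

lemma insertAll_eq (h : Inserted cs l L) : insertAll l cs = L := by
  induction h with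
  | nil => rfl
  | pass cs l L z w m h hzw hw hz ih =>
    rw [insertAll_append, insertAll_pass _ _ _ _ hz, insertAll_replicate, ih]
  | settle cs l L c m h hc hcs ih =>
    have h1 : insertAux c l = (2 * c + 2, 2 * c) :: l := by
      rcases l with _ | ⟨⟨z, w⟩, l⟩
      · rcases c with _ | c <;> rfl
      · simp only [List.head?_cons, Option.mem_def, Option.some.injEq, forall_eq'] at hc
        rcases c with _ | c
        · omega
        · rw [insertAux, if_pos hc]
    rw [← List.singleton_append, insertAll_append]
    change insertAll (insertAux c l) _ = _
    rw [h1, insertAll_append, insertAll_pass, insertAll_replicate, ih]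
    intro c' hc'
    have := hcs c' hc'
    omega

lemma pairwise (h : Inserted cs l L) : cs.Pairwise (· ≥ ·) := by
  have key : ∀ (cs : List ℕ) m, cs.Pairwise (· ≥ ·) →
      (cs.map (· + 1) ++ List.replicate m 0).Pairwise (· ≥ ·) := by
    intro cs m h
    refine List.pairwise_append.2 ⟨?_, ?_, ?_⟩
    · exact List.pairwise_map.2 (h.imp fun h => by omega)
    · exact List.pairwise_replicate.2 (.inr le_rfl)
    · intro a _ b hb
      rw [List.eq_of_mem_replicate hb]
      exact Nat.zero_le a
  induction h with
  | nil => simp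
  | pass cs l L z w m h hzw hw hz ih => exact key _ _ ih
  | settle cs l L c m h hc hcs ih =>
    refine List.pairwise_cons.2 ⟨?_, key _ _ ih⟩
    intro x hx
    simp only [List.mem_append, List.mem_map] at hx
    rcases hx with ⟨c', hc', rfl⟩ | hx
    · exact hcs c' hc'
    · rw [List.eq_of_mem_replicate hx]
      exact Nat.zero_le c

lemma isSplit (h : Inserted cs l L) : ∀ q ∈ l, IsSplit q := by
  induction h with
  | nil => simp
  | pass cs l L z w m h hzw hw hz ih => simpa using ⟨hzw, by simpa using ih⟩
  | settle cs l L c m h hc hcs ih => exact ih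

lemma decreasing_left (h : Inserted cs l L) : Decreasing l := by
  induction h with
  | nil => simp [Decreasing]
  | pass cs l L z w m h hzw hw hz ih =>
    refine ⟨?_, hw, ih⟩
    rcases hzw with h | h <;> simp at h ⊢ <;> omega
  | settle cs l L c m h hc hcs ih => exact ih

/-- The first entry of the result is either the old first entry or 2c for a largest inserted c,
raised in both cases by 2 per inserted pair. This compares a new pair with its right neighbour. -/
lemma head (h : Inserted cs l L) : ∀ Q ∈ L.head?,
    (∃ q ∈ l.head?, Q.1 = q.1 + 2 * cs.length ∧ IsSplit q ∧ ∀ c ∈ cs, 2 * c ≤ q.1) ∨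
    (∃ c ∈ cs, Q.1 = 2 * c + 2 * cs.length ∧ (∀ q ∈ l.head?, q.1 < 2 * c) ∧
      ∀ c' ∈ cs, c' ≤ c) := by
  rcases h with _ | ⟨cs, l, L, z, w, m, h, hzw, hw, hz⟩ | ⟨cs, l, L, c, m, h, hc, hcs⟩
  · simp
  · simp only [List.head?_cons, Option.mem_def, Option.some.injEq, forall_eq',
      exists_eq_left']
    left
    refine ⟨by simp; ring, hzw, ?_⟩
    intro c' hc'
    simp only [List.mem_append, List.mem_map] at hc'
    rcases hc' with ⟨c', hc', rfl⟩ | hx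
    · exact hz c' hc'
    · simp [List.eq_of_mem_replicate hx]
  · simp only [List.head?_cons, Option.mem_def, Option.some.injEq, forall_eq']
    right
    refine ⟨c, by simp, by simp; ring, hc, ?_⟩
    intro c' hc'
    simp only [List.mem_cons, List.mem_append, List.mem_map] at hc'
    rcases hc' with rfl | ⟨c', hc', rfl⟩ | hx
    · rfl
    · exact hcs c' hc'
    · simp [List.eq_of_mem_replicate hx]

lemma decreasing (h : Inserted cs l L) : Decreasing L := by
  induction h with
  | nil => simp [Decreasing]
  | pass cs l L z w m h hzw hw hz ih =>
    have hzw' : w < z ∧ (z = w + 1 ∨ z = w + 2 ∧ Odd w) := by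
      rcases hzw with h | h <;> simp at h ⊢ <;> grind
    refine ⟨by simp only; omega, ?_, ih⟩
    intro Q hQ
    rcases h.head Q hQ with ⟨q, hq, h1, -⟩ | ⟨c, hc, h1, -⟩
    · have := hw q hq
      simp only
      omega
    · have := hz c hc
      -- Here 2c + 2 ≤ z has to yield 2c < w. For z = w + 2 this uses that w is odd.
      rcases hzw'.2 with h2 | ⟨h2, u, hu⟩ <;> simp only <;> omega
  | settle cs l L c m h hc hcs ih =>
    refine ⟨by simp only; omega, ?_, ih⟩
    intro Q hQ
    rcases h.head Q hQ with ⟨q, hq, h1, -⟩ | ⟨c', hc', h1, -⟩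
    · have := hc q hq
      simp only
      omega
    · have := hcs c' hc'
      simp only
      omega

/-- By induction the tail fixes `cs`, hence the shift 2|cs|. Once it is removed, a settled pair has
even second entry and even difference; a passed splitting pair has odd difference, or even
difference and odd second entry. The kind is thus visible, and then so are z and m, or c and m. -/
lemma unique (h : Inserted cs l L) : ∀ {cs' l'}, Inserted cs' l' L → cs = cs' ∧ l = l' := by
  have parity : ∀ z w, IsSplit (z, w) →
      w < z ∧ (z = w + 1 ∨ (z = w + 2 ∧ w % 2 = 1)) := by
    intro z w h
    rcases h with h | ⟨h, u, hu⟩ <;> simp at * <;> omega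
  induction h with
  | nil => intro cs' l' h'; cases h'; simp
  | pass cs l L z w m h hzw hw hz ih =>
    intro cs' l' h'
    have p := parity _ _ hzw
    generalize hM : ((z + 2 * cs.length + 2 * m, w + 2 * cs.length) :: L) = M at h'
    rcases h' with _ | ⟨cs', l', L', z', w', m', h', hzw', hw', hz'⟩ |
      ⟨cs', l', L', c', m', h', hc', hcs'⟩
    · simp at hM
    · simp only [List.cons.injEq, Prod.mk.injEq] at hM
      obtain ⟨⟨h1, h2⟩, rfl⟩ := hM
      obtain ⟨rfl, rfl⟩ := ih h'
      have p' := parity _ _ hzw'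
      obtain ⟨rfl, rfl, rfl⟩ : z = z' ∧ w = w' ∧ m = m' := by omega
      exact ⟨rfl, rfl⟩
    · simp only [List.cons.injEq, Prod.mk.injEq] at hM
      omega
  | settle cs l L c m h hc hcs ih =>
    intro cs' l' h'
    generalize hM : ((2 * c + 2 + 2 * cs.length + 2 * m, 2 * c + 2 * cs.length) :: L) = M at h'
    rcases h' with _ | ⟨cs', l', L', z', w', m', h', hzw', hw', hz'⟩ |
      ⟨cs', l', L', c', m', h', hc', hcs'⟩
    · simp at hM
    · simp only [List.cons.injEq, Prod.mk.injEq] at hM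
      have p' := parity _ _ hzw'
      omega
    · simp only [List.cons.injEq, Prod.mk.injEq] at hM
      obtain ⟨⟨h1, h2⟩, rfl⟩ := hM
      obtain ⟨rfl, rfl⟩ := ih h'
      obtain ⟨rfl, rfl⟩ : c = c' ∧ m = m' := by omega
      exact ⟨rfl, rfl⟩

end Inserted

/-- Positive entries drop by one when they pass the first pair; the zeros, at the end by
monotonicity, are the pairs (2, 0) that it absorbs. -/
lemma exists_eq_map_append_replicate (cs : List ℕ) (h : cs.Pairwise (· ≥ ·)) :
    ∃ (ds : List ℕ) (m : ℕ), cs = ds.map (· + 1) ++ List.replicate m 0 ∧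
      ds.Pairwise (· ≥ ·) := by
  induction cs with
  | nil => exact ⟨[], 0, by simp⟩
  | cons c cs ih =>
    obtain ⟨ds, m, hcs, hds⟩ := ih h.tail
    rcases c with _ | c
    · refine ⟨[], cs.length + 1, ?_, by simp⟩
      rw [List.map_nil, List.nil_append, List.eq_replicate_iff]
      refine ⟨by simp, ?_⟩
      intro b hb
      rcases List.mem_cons.1 hb with rfl | hb
      · rfl
      · simpa using List.rel_of_pairwise_cons h hb
    · refine ⟨c :: ds, m, by simp [hcs], List.pairwise_cons.2 ⟨?_, hds⟩⟩
      intro d hd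
      have := List.rel_of_pairwise_cons h (a' := d + 1) (by simp [hcs, hd])
      omega

/-- Every decreasing sequence can be inserted into every strictly decreasing sequence of splitting
pairs. -/
lemma exists_inserted (N : ℕ) : ∀ (cs : List ℕ) (l : List (ℕ × ℕ)), cs.length + l.length = N →
    cs.Pairwise (· ≥ ·) → Decreasing l → (∀ q ∈ l, IsSplit q) → ∃ L, Inserted cs l L := by
  induction N using Nat.strong_induction_on with
  | _ N ih =>
    intro cs l hN hcs hl hs
    have settle : ∀ c cs, (c :: cs).Pairwise (· ≥ ·) → (c :: cs).length + l.length = N →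
        (∀ q ∈ l.head?, q.1 < 2 * c) → ∃ L, Inserted (c :: cs) l L := by
      intro c cs h hN hq
      obtain ⟨ds, m, rfl, hds⟩ := exists_eq_map_append_replicate cs h.tail
      simp only [List.length_cons, List.length_append, List.length_map,
        List.length_replicate] at hN
      obtain ⟨L, hL⟩ := ih _ (by omega) ds l rfl hds hl hs
      exact ⟨_, .settle ds l L c m hL hq fun c' hc' =>
        List.rel_of_pairwise_cons h (a' := c' + 1) (by simp [hc'])⟩
    rcases l with _ | ⟨⟨z, w⟩, l⟩
    · rcases cs with _ | ⟨c, cs⟩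
      · exact ⟨[], .nil⟩
      · exact settle c cs hcs hN (by simp)
    obtain ⟨ds, m, rfl, hds⟩ := exists_eq_map_append_replicate cs hcs
    -- Either every nonzero moving pair passes the first pair, or the largest one, which comes
    -- first, is stopped by it and settles in front.
    by_cases hz : ∀ d ∈ ds, 2 * (d + 1) ≤ z
    · simp only [List.length_cons, List.length_append, List.length_map,
        List.length_replicate] at hN
      simp only [List.mem_cons, forall_eq_or_imp] at hs
      obtain ⟨L, hL⟩ := ih _ (by omega) ds l rfl hds hl.2.2 hs.2
      exact ⟨_, .pass ds l L z w m hL hs.1 hl.2.1 hz⟩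
    · push Not at hz
      obtain ⟨d, hd, hz⟩ := hz
      rcases ds with _ | ⟨e, ds⟩
      · simp at hd
      refine settle (e + 1) _ hcs hN ?_
      have : d ≤ e := by
        rcases List.mem_cons.1 hd with rfl | hd
        · rfl
        · exact List.rel_of_pairwise_cons hds hd
      simp only [List.head?_cons, Option.mem_def, Option.some.injEq, forall_eq']
      omega

/-- Every strictly decreasing sequence of pairs arises by insertion. -/
lemma exists_of_decreasing (L : List (ℕ × ℕ)) (hL : Decreasing L) :
    ∃ cs l, Inserted cs l L := by
  induction L with
  | nil => exact ⟨[], [], .nil⟩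
  | cons Q L ih =>
    obtain ⟨Z, W⟩ := Q
    obtain ⟨hZW, hhead, hL⟩ := hL
    obtain ⟨cs, l, h⟩ := ih hL
    simp only at hZW hhead
    have hlen : 2 * cs.length ≤ W := by
      rcases L with _ | ⟨Q, L⟩
      · cases h
        simp
      · have := hhead Q (by simp)
        rcases h.head Q (by simp) with ⟨q, -, h1, -⟩ | ⟨c, -, h1, -⟩ <;> omega
    have hne : L = [] → cs = [] ∧ l = [] := by
      rintro rfl
      cases h
      simp
    have hcs : ∀ c ∈ cs, 2 * c + 2 * cs.length < W := by
      rcases L with _ | ⟨Q, L⟩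
      · simp [hne rfl]
      intro c hc
      have := hhead Q (by simp)
      rcases h.head Q (by simp) with ⟨q, -, h1, -, h2⟩ | ⟨c', -, h1, -, h2⟩ <;>
        have := h2 c hc <;> omega
    have hl : ∀ q ∈ l.head?, q.1 + 2 * cs.length < W := by
      rcases L with _ | ⟨Q, L⟩
      · simp [hne rfl]
      intro q hq
      have := hhead Q (by simp)
      rcases h.head Q (by simp) with ⟨q', hq', h1, -, h2⟩ | ⟨c', -, h1, h2, -⟩
      · obtain rfl : q = q' := Option.some_injective _ (hq.symm.trans hq')
        omega
      · have := h2 q hq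
        omega
    obtain ⟨w, rfl⟩ := Nat.exists_eq_add_of_le' hlen
    have pass : ∀ z m, IsSplit (z, w) → Z = z + 2 * cs.length + 2 * m →
        ∃ cs' l', Inserted cs' l' ((Z, w + 2 * cs.length) :: L) := by
      rintro z m hz rfl
      have hz' : w + 1 ≤ z := by rcases hz with h | h <;> simp at h <;> omega
      refine ⟨_, _, .pass cs l L z w m h hz (fun q hq => ?_) (fun c hc => ?_)⟩
      · have := hl q hq
        omega
      · have := hcs c hc
        omega
    -- With the shift removed, w and the difference both even means a settled pair. Otherwise the
    -- splitting pair is (w + 1, w) for odd difference and (w + 2, w) for even. A positive even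
    -- difference contains the original 2, whence m - 1 absorptions.
    rcases Nat.even_or_odd' w with ⟨c, rfl | rfl⟩
    · rcases Nat.even_or_odd' (Z - (2 * c + 2 * cs.length)) with ⟨m, hm | hm⟩
      · obtain rfl : Z = 2 * c + 2 + 2 * cs.length + 2 * (m - 1) := by omega
        refine ⟨_, _, .settle cs l L c (m - 1) h (fun q hq => ?_) (fun c' hc' => ?_)⟩
        · have := hl q hq
          omega
        · have := hcs c' hc'
          omega
      · exact pass (2 * c + 1) m (.inl rfl) (by omega)
    · rcases Nat.even_or_odd' (Z - (2 * c + 1 + 2 * cs.length)) with ⟨m, hm | hm⟩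
      · exact pass (2 * c + 1 + 2) (m - 1) (.inr ⟨rfl, c, rfl⟩) (by omega)
      · exact pass (2 * c + 1 + 1) m (.inl rfl) (by omega)

/-! ### Sum, alternating sum and number of odd entries -/

/-- The sum of all entries, the sum of the differences and the number of odd entries of a sequence
of pairs. -/
def stats (L : List (ℕ × ℕ)) : ℕ × ℤ × ℕ :=
  (L.map fun q => (q.1 + q.2, (q.1 : ℤ) - q.2, q.1 % 2 + q.2 % 2)).sum

lemma stats_cons (q : ℕ × ℕ) (L : List (ℕ × ℕ)) :
    stats (q :: L) = (q.1 + q.2, (q.1 : ℤ) - q.2, q.1 % 2 + q.2 % 2) + stats L := by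
  simp [stats]

lemma stats_append (L M : List (ℕ × ℕ)) : stats (L ++ M) = stats L + stats M := by
  simp [stats]

lemma PairInterchange.stats_eq {L M : List (ℕ × ℕ)} (h : PairInterchange L M) :
    stats L = stats M := by
  obtain ⟨u, v, a, b, ha, hb, hab⟩ := h
  simp only [stats_append, stats_cons, ← add_assoc]
  congr 1
  simp only [add_assoc]
  congr 1
  ext <;> simp <;> omega

/-- Each pass transfers 4 from the sum of the moving pair to the passed one and changes no
difference or parity; so only the initial pair (2c + 2, 2c) counts. -/
lemma stats_insertAux (c : ℕ) : ∀ L : List (ℕ × ℕ),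
    stats (insertAux c L) = (2 * (2 * c + 1), 2, 0) + stats L := by
  induction c with
  | zero =>
    intro L
    rcases L with _ | ⟨⟨z, w⟩, L⟩
    · simp [insertAux, stats]
    · simp only [insertAux, stats_cons, ← add_assoc]
      congr 1
      ext <;> simp <;> omega
  | succ c ih =>
    intro L
    rcases L with _ | ⟨⟨z, w⟩, L⟩
    · simp only [insertAux, stats_cons]
      congr 1
      ext <;> simp
      omega
    · rw [insertAux]
      split_ifs
      · simp only [stats_cons, ← add_assoc]
        congr 2
        ext <;> simp
        omega
      · simp only [stats_cons, ih, ← add_assoc]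
        congr 1
        ext <;> simp <;> omega

lemma stats_insertAll (cs : List ℕ) : ∀ L : List (ℕ × ℕ),
    stats (insertAll L cs) =
      (2 * (cs.map (2 * · + 1)).sum, 2 * (cs.length : ℤ), 0) + stats L := by
  induction cs with
  | nil => intro L; simp [insertAll]
  | cons c cs ih =>
    intro L
    have := ih (insertAux c L)
    simp only [insertAll, List.foldl_cons] at this ⊢
    rw [this, stats_insertAux, ← add_assoc]
    congr 1
    ext <;> simp <;> ring

/-- A double has difference 1 and one odd entry, a couple has difference 2 and two odd entries: both
numbers count the odd parts used. -/
lemma stats_map_toPair (l : List Block) : stats (l.map toPair) =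
    ((oddParts l).sum, ((oddParts l).length : ℤ), (oddParts l).length) := by
  induction l with
  | nil => simp [stats, oddParts]; rfl
  | cons x l ih =>
    rw [List.map_cons, stats_cons, ih]
    rcases x with a | b <;> ext <;> simp [toPair, oddParts] <;> omega

lemma stats_toPairs (X : List ℕ) : stats (toPairs X) =
    (X.sum, ∑ j ∈ Finset.range X.length, (-1 : ℤ) ^ j * (X.getD j 0 : ℤ),
      X.countP (fun x => Odd x)) := by
  induction X using toPairs.induct with
  | case1 => simp [toPairs, stats]; rfl
  | case2 x =>
    ext <;> simp [toPairs, stats, List.countP_cons, Nat.odd_iff]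
    split_ifs <;> omega
  | case3 x y l ih =>
    rw [toPairs, stats_cons, ih]
    ext
    · simp [add_assoc]
    · simp only [Prod.snd_add, Prod.fst_add, List.length_cons, Finset.sum_range_succ', pow_succ,
        List.getD_cons_succ, List.getD_cons_zero, pow_zero]
      simp
      ring
    · simp only [Prod.snd_add, List.countP_cons, Nat.odd_iff, decide_eq_true_eq]
      split_ifs <;> omega

/-! ### Sequences of parts and sequences of pairs -/

section lists

lemma ofPairs_cons (z w : ℕ) (L : List (ℕ × ℕ)) (hz : z ≠ 0) :
    ofPairs ((z, w) :: L) = z :: (if w = 0 then ofPairs L else w :: ofPairs L) := by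
  simp only [ofPairs, List.flatMap_cons, List.filter_append]
  split_ifs with hw <;> simp [hz, hw]

lemma head?_ofPairs {L : List (ℕ × ℕ)} (h : Decreasing L) :
    (ofPairs L).head? = L.head?.map Prod.fst := by
  rcases L with _ | ⟨⟨z, w⟩, L⟩
  · rfl
  · have := h.1
    rw [ofPairs_cons _ _ _ (by simp at this; omega)]
    rfl

lemma isChain_ofPairs (L : List (ℕ × ℕ)) (h : Decreasing L) :
    (ofPairs L).IsChain (· > ·) := by
  induction L with
  | nil => simp [ofPairs]
  | cons q L ih =>
    obtain ⟨z, w⟩ := q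
    obtain ⟨h1, h2, h3⟩ := h
    have hh := head?_ofPairs h3
    rw [ofPairs_cons _ _ _ (by simp at h1; omega)]
    have key : ∀ y ∈ (ofPairs L).head?, y < w := by
      intro y hy
      rw [hh, Option.mem_map] at hy
      obtain ⟨q, hq, rfl⟩ := hy
      exact h2 q hq
    split_ifs with hw
    · refine List.isChain_cons.2 ⟨fun y hy => ?_, ih h3⟩
      have := key y hy
      simp only at h1
      omega
    · exact List.isChain_cons_cons.2 ⟨h1, List.isChain_cons.2 ⟨key, ih h3⟩⟩

/-- In a decreasing sequence only the very last entry can be 0, so discarding zeros does not disturb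
the pairing. -/
lemma toPairs_ofPairs (L : List (ℕ × ℕ)) (h : Decreasing L) : toPairs (ofPairs L) = L := by
  induction L with
  | nil => simp [ofPairs, toPairs]
  | cons q L ih =>
    obtain ⟨z, w⟩ := q
    obtain ⟨h1, h2, h3⟩ := h
    rw [ofPairs_cons _ _ _ (by simp at h1; omega)]
    split_ifs with hw
    · rcases L with _ | ⟨r, L⟩
      · simp [ofPairs, toPairs, hw]
      · have := h2 r (by simp)
        simp only at this
        omega
    · rw [toPairs, ih h3]

lemma ofPairs_toPairs (X : List ℕ) (h0 : 0 ∉ X) : ofPairs (toPairs X) = X := by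
  induction X using toPairs.induct with
  | case1 => simp [toPairs, ofPairs]
  | case2 x =>
    simp only [List.mem_singleton] at h0
    simp [toPairs, ofPairs, Ne.symm h0]
  | case3 x y l ih =>
    simp only [List.mem_cons, not_or] at h0
    rw [toPairs, ofPairs_cons _ _ _ (Ne.symm h0.1), if_neg (Ne.symm h0.2.1), ih h0.2.2]

lemma decreasing_toPairs (X : List ℕ) (h : X.IsChain (· > ·)) (h0 : 0 ∉ X) :
    Decreasing (toPairs X) := by
  induction X using toPairs.induct with
  | case1 => simp [toPairs, Decreasing]
  | case2 x =>
    simp only [List.mem_singleton] at h0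
    simpa [toPairs, Decreasing] using Nat.pos_of_ne_zero (Ne.symm h0)
  | case3 x y l ih =>
    simp only [List.mem_cons, not_or] at h0
    rw [List.isChain_cons_cons] at h
    refine ⟨h.1, ?_, ih h.2.tail h0.2.2⟩
    rcases l with _ | ⟨z, _ | ⟨u, l⟩⟩
    · simp [toPairs]
    · simpa [toPairs] using (List.isChain_cons_cons.1 h.2).1
    · simpa [toPairs] using (List.isChain_cons_cons.1 h.2).1

lemma zero_notMem_ofPairs (L : List (ℕ × ℕ)) : 0 ∉ ofPairs L := by
  simp [ofPairs]

lemma decreasing_map_toPair_iff (l : List Block) :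
    Decreasing (l.map toPair) ↔ l.IsChain (Adj 2) := by
  induction l with
  | nil => simp [Decreasing]
  | cons x l ih =>
    rw [List.map_cons, Decreasing, ih, List.isChain_cons]
    rcases l with _ | ⟨y, l⟩
    · rcases x with _ | _ <;> simp [toPair]
    · simp only [List.map_cons, List.head?_cons, Option.mem_def, Option.some.injEq, forall_eq']
      rw [← and_assoc]
      refine and_congr_left fun _ => ?_
      rcases x with _ | _ <;> rcases y with _ | _ <;> simp only [toPair, Adj] <;> omega

lemma isSplit_toPair (x : Block) : IsSplit x.toPair := by
  rcases x with a | b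
  · exact .inl rfl
  · exact .inr ⟨rfl, b, rfl⟩

lemma exists_map_toPair (L : List (ℕ × ℕ)) (h : ∀ q ∈ L, IsSplit q) :
    ∃ l : List Block, l.map toPair = L := by
  have : ∀ q, IsSplit q → ∃ x : Block, x.toPair = q := by
    rintro ⟨z, w⟩ (h | ⟨h, b, hb⟩)
    · exact ⟨single w, by simp at h; simp [toPair, h]⟩
    · exact ⟨couple b, by simp at h hb; simp [toPair, h, hb]⟩
  induction L with
  | nil => exact ⟨[], rfl⟩
  | cons q L ih =>
    simp only [List.mem_cons, forall_eq_or_imp] at h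
    obtain ⟨x, rfl⟩ := this q h.1
    obtain ⟨l, rfl⟩ := ih h.2
    exact ⟨x :: l, rfl⟩

lemma desc_coe {X : List ℕ} (h : X.IsChain (· > ·)) : desc X = X := by
  refine List.Perm.eq_of_pairwise (le := (· ≥ ·)) (fun a b _ _ h1 h2 => le_antisymm h2 h1)
    (Multiset.pairwise_sort _ _) ?_ ?_
  · exact (List.isChain_iff_pairwise.1 h).imp le_of_lt
  · rw [← Multiset.coe_eq_coe, desc, Multiset.sort_eq]

lemma coe_desc (s : Multiset ℕ) : (desc s : Multiset ℕ) = s := Multiset.sort_eq _ _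

lemma mem_desc {s : Multiset ℕ} {x : ℕ} : x ∈ desc s ↔ x ∈ s := Multiset.mem_sort _

lemma desc_injective : Function.Injective desc := fun s t h => by
  rw [← coe_desc s, h, coe_desc]

lemma pairwise_desc (s : Multiset ℕ) : (desc s).Pairwise (· ≥ ·) := Multiset.pairwise_sort _ _

lemma isChain_desc {s : Multiset ℕ} (h : s.Nodup) : (desc s).IsChain (· > ·) := by
  rw [← coe_desc s, Multiset.coe_nodup] at h
  exact List.isChain_iff_pairwise.2
    (((pairwise_desc s).and h).imp fun h => lt_of_le_of_ne h.1 (Ne.symm h.2))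

lemma nodup_coe {X : List ℕ} (h : X.IsChain (· > ·)) : (X : Multiset ℕ).Nodup :=
  Multiset.coe_nodup.2 ((List.isChain_iff_pairwise.1 h).imp ne_of_gt)

end lists

/-! ### Bressoud's map on multisets -/

/-- Multisets of distinct odd numbers. -/
def IsOddDistinct (β : Multiset ℕ) : Prop := β.Nodup ∧ ∀ x ∈ β, Odd x

/-- Multisets of distinct positive numbers that form splitting pairs. -/
def IsSplitting (ν : Multiset ℕ) : Prop :=
  ν.Nodup ∧ 0 ∉ ν ∧ ∀ q ∈ toPairs (desc ν), IsSplit q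

/-- Sum, alternating sum and number of odd parts. -/
lemma stats_toPairs_desc (μ : Multiset ℕ) : (stats (toPairs (desc μ))).1 = μ.sum ∧
    (stats (toPairs (desc μ))).2.2 = μ.countP (fun x => Odd x) := by
  rw [stats_toPairs]
  constructor
  · simp [← Multiset.sum_coe, coe_desc]
  · simp [← Multiset.coe_countP, coe_desc]

lemma IsOddDistinct.exists_blocks {β : Multiset ℕ} (h : IsOddDistinct β) :
    ∃ u : List Block, u.IsChain (Adj 1) ∧ oddParts u = desc β :=
  exists_oddParts _ _ rfl (isChain_desc h.1) fun x hx => h.2 x (mem_desc.1 hx)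

lemma isOddDistinct_oddParts {u : List Block} (hu : u.IsChain (Adj 1)) :
    IsOddDistinct (oddParts u) :=
  ⟨nodup_coe (isChain_oddParts u hu), odd_of_mem_oddParts u⟩

lemma IsSplitting.exists_blocks {ν : Multiset ℕ} (h : IsSplitting ν) :
    ∃ l : List Block, l.IsChain (Adj 2) ∧ l.map toPair = toPairs (desc ν) := by
  obtain ⟨l, hl⟩ := exists_map_toPair _ h.2.2
  refine ⟨l, ?_, hl⟩
  rw [← decreasing_map_toPair_iff, hl]
  exact decreasing_toPairs _ (isChain_desc h.1) fun h0 => h.2.1 (mem_desc.1 h0)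

lemma eq_coe_iff {X : List ℕ} (hX : X.IsChain (· > ·)) (μ : Multiset ℕ) :
    X = desc μ ↔ μ = X := by
  constructor
  · rintro rfl
    exact (coe_desc μ).symm
  · rintro rfl
    exact (desc_coe hX).symm

lemma isChain_ofPairs_map {l : List Block} (hl : l.IsChain (Adj 2)) :
    (ofPairs (l.map toPair)).IsChain (· > ·) :=
  isChain_ofPairs _ ((decreasing_map_toPair_iff l).2 hl)

/-- Interchanges disappear from the description: the image is read off from equality of invariants.
Uniqueness, injectivity and surjectivity rest on this. -/
lemma bressoudMap_iff {u : List Block} (hu : u.IsChain (Adj 1)) (ν : Multiset ℕ) :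
    BressoudMap (oddParts u) ν ↔ ∃ l : List Block, l.IsChain (Adj 2) ∧
      (singles 0 u = singles 0 l ∧ couples 0 u = couples 0 l) ∧
      ν = ofPairs (l.map toPair) := by
  rw [BressoudMap, desc_coe (isChain_oddParts u hu), pairing_oddParts u hu]
  constructor
  · rintro ⟨L, h, hirr, hL⟩
    obtain ⟨l, hl, rfl⟩ := (reflTransGen_map_iff u L).1 h
    have := (normal_form_iff hu l).1
      ⟨hl, fun l' hl' => hirr _ ((pairInterchange_map_iff _ _).2 ⟨l', hl', rfl⟩)⟩
    exact ⟨l, this.1, this.2, (eq_coe_iff (isChain_ofPairs_map this.1) ν).1 hL⟩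
  · rintro ⟨l, hl, heq, hν⟩
    have := (normal_form_iff hu l).2 ⟨hl, heq⟩
    refine ⟨l.map toPair, (reflTransGen_map_iff u _).2 ⟨l, this.1, rfl⟩, ?_,
      (eq_coe_iff (isChain_ofPairs_map hl) ν).2 hν⟩
    intro L hL
    obtain ⟨l', hl', -⟩ := (pairInterchange_map_iff _ _).1 hL
    exact this.2 l' hl'

lemma BressoudMap.exists_blocks {β ν : Multiset ℕ} (hβ : IsOddDistinct β) (h : BressoudMap β ν) :
    ∃ u l : List Block, u.IsChain (Adj 1) ∧ l.IsChain (Adj 2) ∧ singles 0 u = singles 0 l ∧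
      couples 0 u = couples 0 l ∧ β = oddParts u ∧ ν = ofPairs (l.map toPair) := by
  obtain ⟨u, hu, hβu⟩ := hβ.exists_blocks
  obtain rfl : β = oddParts u := by rw [hβu, coe_desc]
  obtain ⟨l, hl, ⟨hs, hc⟩, hν⟩ := (bressoudMap_iff hu ν).1 h
  exact ⟨u, l, hu, hl, hs, hc, rfl, hν⟩

lemma BressoudMap.unique {β ν ν' : Multiset ℕ} (hβ : IsOddDistinct β) (h : BressoudMap β ν)
    (h' : BressoudMap β ν') : ν = ν' := by
  obtain ⟨u, l, hu, hl, hs, hc, rfl, rfl⟩ := h.exists_blocks hβ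
  obtain ⟨l', hl', ⟨hs', hc'⟩, rfl⟩ := (bressoudMap_iff hu _).1 h'
  rw [eq_of_singles_couples (.inr rfl) l l' 0 0 hl hl' (hs.symm.trans hs') (hc.symm.trans hc')]

lemma BressoudMap.injective {β β' ν : Multiset ℕ} (hβ : IsOddDistinct β)
    (hβ' : IsOddDistinct β') (h : BressoudMap β ν) (h' : BressoudMap β' ν) : β = β' := by
  obtain ⟨u, l, hu, hl, hs, hc, rfl, rfl⟩ := h.exists_blocks hβ
  obtain ⟨u', l', hu', hl', hs', hc', rfl, hl''⟩ := h'.exists_blocks hβ'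
  have := (eq_coe_iff (isChain_ofPairs_map hl') _).2 hl''
  rw [desc_coe (isChain_ofPairs_map hl)] at this
  have := congrArg toPairs this
  rw [toPairs_ofPairs _ ((decreasing_map_toPair_iff l).2 hl),
    toPairs_ofPairs _ ((decreasing_map_toPair_iff l').2 hl')] at this
  obtain rfl := toPair_injective.list_map this
  rw [eq_of_singles_couples (.inl rfl) u u' 0 0 hu hu' (hs.trans hs'.symm) (hc.trans hc'.symm)]

lemma exists_bressoudMap {β : Multiset ℕ} (hβ : IsOddDistinct β) : ∃ ν, BressoudMap β ν := by
  obtain ⟨u, hu, hβu⟩ := hβ.exists_blocks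
  obtain rfl : β = oddParts u := by rw [hβu, coe_desc]
  obtain ⟨l, h⟩ := exists_irreducible _ u rfl
  exact ⟨_, (bressoudMap_iff hu _).2
    ⟨l, ((normal_form_iff hu l).1 h).1, ((normal_form_iff hu l).1 h).2, rfl⟩⟩

lemma exists_bressoudMap_of_isSplitting {ν : Multiset ℕ} (hν : IsSplitting ν) :
    ∃ β, IsOddDistinct β ∧ BressoudMap β ν := by
  obtain ⟨l, hl, hlν⟩ := hν.exists_blocks
  obtain ⟨u, hu, h⟩ := exists_initial hl
  refine ⟨_, isOddDistinct_oddParts hu, (bressoudMap_iff hu _).2 ⟨l, hl, h, ?_⟩⟩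
  rw [hlν, ofPairs_toPairs _ fun h0 => hν.2.1 (mem_desc.1 h0), coe_desc]

lemma BressoudMap.isSplitting {β ν : Multiset ℕ} (hβ : IsOddDistinct β) (h : BressoudMap β ν) :
    IsSplitting ν := by
  obtain ⟨u, l, hu, hl, hs, hc, rfl, rfl⟩ := h.exists_blocks hβ
  refine ⟨nodup_coe (isChain_ofPairs_map hl), zero_notMem_ofPairs _, ?_⟩
  rw [desc_coe (isChain_ofPairs_map hl), toPairs_ofPairs _ ((decreasing_map_toPair_iff l).2 hl)]
  intro q hq
  obtain ⟨x, -, rfl⟩ := List.mem_map.1 hq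
  exact isSplit_toPair x

lemma BressoudMap.stats_eq {β ν : Multiset ℕ} (hβ : IsOddDistinct β) (h : BressoudMap β ν) :
    stats (toPairs (desc ν)) = (β.sum, (β.card : ℤ), β.card) := by
  have hν := h.isSplitting hβ
  obtain ⟨u, hu, hβu⟩ := hβ.exists_blocks
  obtain rfl : β = oddParts u := by rw [hβu, coe_desc]
  obtain ⟨l, hl, ⟨hs, hc⟩, rfl⟩ := (bressoudMap_iff hu ν).1 h
  have h1 := (reflTransGen_map_iff u _).2 ⟨l, ((normal_form_iff hu l).2 ⟨hl, hs, hc⟩).1, rfl⟩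
  have h2 : stats (u.map toPair) = stats (l.map toPair) := by
    generalize l.map toPair = L at h1
    induction h1 with
    | refl => rfl
    | tail _ h ih => exact ih.trans h.stats_eq
  rw [desc_coe (isChain_ofPairs_map hl), toPairs_ofPairs _ ((decreasing_map_toPair_iff l).2 hl),
    ← h2, stats_map_toPair]
  simp

/-! ### Separating repeated parts, and the extended map -/

section squares

lemma exists_eq_add_add (p : Multiset ℕ) :
    ∃ α β : Multiset ℕ, p = α + α + β ∧ β.Nodup := by
  induction p using Multiset.induction_on with
  | empty => exact ⟨0, 0, by simp⟩
  | cons x p ih =>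
    obtain ⟨α, β, rfl, hβ⟩ := ih
    by_cases hx : x ∈ β
    · obtain ⟨γ, rfl⟩ := Multiset.exists_cons_of_mem hx
      refine ⟨x ::ₘ α, γ, ?_, (Multiset.nodup_cons.1 hβ).2⟩
      simp only [← Multiset.singleton_add]
      abel
    · refine ⟨α, x ::ₘ β, ?_, Multiset.nodup_cons.2 ⟨hx, hβ⟩⟩
      simp only [← Multiset.singleton_add]
      abel

/-- Multiplicities in β are at most 1, hence are the parities of those in the whole multiset. -/
lemma eq_of_add_add_eq {α β α' β' : Multiset ℕ} (h : α + α + β = α' + α' + β') (hβ : β.Nodup)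
    (hβ' : β'.Nodup) : α = α' ∧ β = β' := by
  have key : ∀ x, α.count x = α'.count x ∧ β.count x = β'.count x := by
    intro x
    have h1 := congrArg (Multiset.count x) h
    simp only [Multiset.count_add] at h1
    have h2 := Multiset.nodup_iff_count_le_one.1 hβ x
    have h3 := Multiset.nodup_iff_count_le_one.1 hβ' x
    omega
  exact ⟨Multiset.ext.2 fun x => (key x).1, Multiset.ext.2 fun x => (key x).2⟩

lemma card_filter_odd_count {α β : Multiset ℕ} (hβ : β.Nodup) :
    ((α + α + β).toFinset.filter (fun i => Odd ((α + α + β).count i))).card = β.card := by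
  rw [← Multiset.toFinset_card_of_nodup hβ]
  congr 1
  ext x
  have h2 := Multiset.nodup_iff_count_le_one.1 hβ x
  simp only [Finset.mem_filter, Multiset.mem_toFinset, Multiset.mem_add, Multiset.count_add,
    Nat.odd_iff]
  constructor
  · rintro ⟨-, h⟩
    rw [← Multiset.one_le_count_iff_mem]
    omega
  · intro h
    refine ⟨.inr h, ?_⟩
    rw [← Multiset.one_le_count_iff_mem] at h
    omega

end squares

/-- The sequence of the `c` for which the odd numbers `2c + 1` in `α` are inserted. -/
def halves (α : Multiset ℕ) : List ℕ := (desc α).map fun x => (x - 1) / 2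

lemma foldl_insertPair (α : Multiset ℕ) (L : List (ℕ × ℕ)) :
    (desc α).foldl insertPair L = insertAll L (halves α) := by
  rw [insertAll, halves, List.foldl_map]
  rfl

lemma pairwise_halves (α : Multiset ℕ) : (halves α).Pairwise (· ≥ ·) :=
  List.pairwise_map.2 ((pairwise_desc α).imp fun h =>
    Nat.div_le_div_right (Nat.sub_le_sub_right h 1))

lemma map_halves {α : Multiset ℕ} (h : ∀ x ∈ α, Odd x) :
    (halves α).map (2 * · + 1) = desc α := by
  rw [halves, List.map_map]
  conv_rhs => rw [← List.map_id (desc α)]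
  refine List.map_congr_left fun x hx => ?_
  obtain ⟨k, rfl⟩ := h x (mem_desc.1 hx)
  simp

lemma halves_map {cs : List ℕ} (h : cs.Pairwise (· ≥ ·)) :
    halves (cs.map (2 * · + 1) : List ℕ) = cs := by
  have : desc (cs.map (2 * · + 1) : List ℕ) = cs.map (2 * · + 1) := by
    refine List.Perm.eq_of_pairwise (le := (· ≥ ·)) (fun a b _ _ h1 h2 => le_antisymm h2 h1)
      (pairwise_desc _) (List.pairwise_map.2 (h.imp fun h => by omega)) ?_
    rw [← Multiset.coe_eq_coe, coe_desc]
  rw [halves, this, List.map_map]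
  conv_rhs => rw [← List.map_id cs]
  refine List.map_congr_left fun x _ => ?_
  simp

/-- The extended map in terms of `Inserted`. -/
lemma extendedMap_iff {p : Multiset ℕ} (hp : ∀ x ∈ p, Odd x) (μ : Multiset ℕ) :
    ExtendedMap p μ ↔ ∃ (α β ν : Multiset ℕ) (L : List (ℕ × ℕ)), p = α + α + β ∧
      IsOddDistinct β ∧ BressoudMap β ν ∧ Inserted (halves α) (toPairs (desc ν)) L ∧
      μ = ofPairs L := by
  constructor
  · rintro ⟨α, β, ν, rfl, hβ, hν, h⟩
    have hβ' : IsOddDistinct β := ⟨hβ, fun x hx => hp x (by simp [hx])⟩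
    have hs := hν.isSplitting hβ'
    obtain ⟨L, hL⟩ := exists_inserted _ (halves α) (toPairs (desc ν)) rfl (pairwise_halves α)
      (decreasing_toPairs _ (isChain_desc hs.1) fun h0 => hs.2.1 (mem_desc.1 h0)) hs.2.2
    refine ⟨α, β, ν, L, rfl, hβ', hν, hL, ?_⟩
    rw [foldl_insertPair, hL.insertAll_eq] at h
    rw [h, coe_desc]
  · rintro ⟨α, β, ν, L, hp, hβ, hν, hL, rfl⟩
    refine ⟨α, β, ν, hp, hβ.1, hν, ?_⟩
    rw [foldl_insertPair, hL.insertAll_eq, desc_coe (isChain_ofPairs _ hL.decreasing)]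

lemma ExtendedMap.unique {p μ μ' : Multiset ℕ} (hp : ∀ x ∈ p, Odd x) (h : ExtendedMap p μ)
    (h' : ExtendedMap p μ') : μ = μ' := by
  obtain ⟨α, β, ν, L, rfl, hβ, hν, hL, rfl⟩ := (extendedMap_iff hp μ).1 h
  obtain ⟨α', β', ν', L', hp', hβ', hν', hL', rfl⟩ := (extendedMap_iff hp μ').1 h'
  obtain ⟨rfl, rfl⟩ := eq_of_add_add_eq hp' hβ.1 hβ'.1
  obtain rfl := hν.unique hβ hν'
  rw [← hL.insertAll_eq, ← hL'.insertAll_eq]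

lemma exists_extendedMap {p : Multiset ℕ} (hp : ∀ x ∈ p, Odd x) : ∃ μ, ExtendedMap p μ := by
  obtain ⟨α, β, rfl, hβ⟩ := exists_eq_add_add p
  have hβ' : IsOddDistinct β := ⟨hβ, fun x hx => hp x (by simp [hx])⟩
  obtain ⟨ν, hν⟩ := exists_bressoudMap hβ'
  have hs := hν.isSplitting hβ'
  obtain ⟨L, hL⟩ := exists_inserted _ (halves α) (toPairs (desc ν)) rfl (pairwise_halves α)
    (decreasing_toPairs _ (isChain_desc hs.1) fun h0 => hs.2.1 (mem_desc.1 h0)) hs.2.2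
  exact ⟨_, (extendedMap_iff hp _).2 ⟨α, β, ν, L, rfl, hβ', hν, hL, rfl⟩⟩

lemma ExtendedMap.injective {p p' μ : Multiset ℕ} (hp : ∀ x ∈ p, Odd x) (hp' : ∀ x ∈ p', Odd x)
    (h : ExtendedMap p μ) (h' : ExtendedMap p' μ) : p = p' := by
  obtain ⟨α, β, ν, L, rfl, hβ, hν, hL, rfl⟩ := (extendedMap_iff hp μ).1 h
  obtain ⟨α', β', ν', L', rfl, hβ', hν', hL', hLL'⟩ := (extendedMap_iff hp' _).1 h'
  have := (eq_coe_iff (isChain_ofPairs _ hL'.decreasing) _).2 hLL'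
  rw [desc_coe (isChain_ofPairs _ hL.decreasing)] at this
  have := congrArg toPairs this
  rw [toPairs_ofPairs _ hL.decreasing, toPairs_ofPairs _ hL'.decreasing] at this
  subst this
  obtain ⟨h1, h2⟩ := hL.unique hL'
  have hα : α = α' := desc_injective (by
    rw [← map_halves fun x hx => hp x (by simp [hx]), h1,
      map_halves fun x hx => hp' x (by simp [hx])])
  have h3 := congrArg ofPairs h2
  rw [ofPairs_toPairs _ fun h0 => (hν.isSplitting hβ).2.1 (mem_desc.1 h0),
    ofPairs_toPairs _ fun h0 => (hν'.isSplitting hβ').2.1 (mem_desc.1 h0)] at h3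
  obtain rfl := desc_injective h3
  rw [hα, hν.injective hβ hβ' hν']

lemma exists_extendedMap_of_nodup {μ : Multiset ℕ} (hμ : μ.Nodup) (h0 : 0 ∉ μ) :
    ∃ p : Multiset ℕ, (∀ x ∈ p, Odd x) ∧ ExtendedMap p μ := by
  have h0' : 0 ∉ desc μ := fun h => h0 (mem_desc.1 h)
  obtain ⟨cs, l, h⟩ := exists_of_decreasing _ (decreasing_toPairs _ (isChain_desc hμ) h0')
  have hl := isChain_ofPairs _ h.decreasing_left
  have hs : IsSplitting (ofPairs l) := by
    refine ⟨nodup_coe hl, zero_notMem_ofPairs l, ?_⟩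
    rw [desc_coe hl, toPairs_ofPairs _ h.decreasing_left]
    exact h.isSplit
  obtain ⟨β, hβ, hβl⟩ := exists_bressoudMap_of_isSplitting hs
  obtain ⟨α, hα⟩ : ∃ α : Multiset ℕ, α = (cs.map (2 * · + 1) : List ℕ) := ⟨_, rfl⟩
  have hp : ∀ x ∈ α + α + β, Odd x := by
    have : ∀ x ∈ α, Odd x := by
      intro x hx
      obtain ⟨c, -, rfl⟩ := List.mem_map.1 (Multiset.mem_coe.1 (hα ▸ hx))
      exact ⟨c, rfl⟩
    intro x hx
    simp only [Multiset.mem_add, or_self] at hx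
    exact hx.elim (this x) (hβ.2 x)
  refine ⟨_, hp, (extendedMap_iff hp μ).2 ⟨α, β, ofPairs l, toPairs (desc μ), rfl, hβ, hβl, ?_, ?_⟩⟩
  · rwa [hα, halves_map h.pairwise, desc_coe hl, toPairs_ofPairs _ h.decreasing_left]
  · rw [ofPairs_toPairs _ h0', coe_desc]

lemma ExtendedMap.nodup {p μ : Multiset ℕ} (hp : ∀ x ∈ p, Odd x) (h : ExtendedMap p μ) :
    μ.Nodup ∧ 0 ∉ μ := by
  obtain ⟨α, β, ν, L, rfl, hβ, hν, hL, rfl⟩ := (extendedMap_iff hp μ).1 h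
  exact ⟨nodup_coe (isChain_ofPairs _ hL.decreasing), zero_notMem_ofPairs L⟩

lemma ExtendedMap.stats_eq {p μ : Multiset ℕ} (hp : ∀ x ∈ p, Odd x) (h : ExtendedMap p μ) :
    stats (toPairs (desc μ)) = (p.sum, (p.card : ℤ),
      (p.toFinset.filter (fun i => Odd (p.count i))).card) := by
  obtain ⟨α, β, ν, L, rfl, hβ, hν, hL, rfl⟩ := (extendedMap_iff hp μ).1 h
  have hsum : ((halves α).map (2 * · + 1)).sum = α.sum := by
    rw [map_halves fun x hx => hp x (by simp [hx]), ← Multiset.sum_coe, coe_desc]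
  have hlen : (halves α).length = α.card := by
    rw [halves, List.length_map, ← Multiset.coe_card, coe_desc]
  rw [desc_coe (isChain_ofPairs _ hL.decreasing), toPairs_ofPairs _ hL.decreasing,
    ← hL.insertAll_eq, stats_insertAll, hν.stats_eq hβ, card_filter_odd_count hβ.1, hsum, hlen]
  ext <;> simp <;> ring

lemma BressoudMap.extendedMap {β ν : Multiset ℕ} (hβ : IsOddDistinct β) (h : BressoudMap β ν) :
    ExtendedMap β ν := by
  refine ⟨0, β, ν, by simp, hβ.1, h, ?_⟩
  have : desc 0 = [] := by simp [desc]
  rw [this]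
  exact ofPairs_toPairs _ fun h0 => (h.isSplitting hβ).2.1 (mem_desc.1 h0)

/-! ### Partitions of n and the final bijections -/

lemma getD_toPairs (X : List ℕ) : ∀ j, X.getD (2 * j) 0 = ((toPairs X).getD j (0, 0)).1 ∧
    X.getD (2 * j + 1) 0 = ((toPairs X).getD j (0, 0)).2 := by
  induction X using toPairs.induct with
  | case1 => simp [toPairs]
  | case2 x => intro j; rcases j with _ | j <;> simp [toPairs, mul_add]
  | case3 x y l ih =>
    intro j
    rcases j with _ | j
    · simp [toPairs]
    · simpa [toPairs, mul_add] using ih j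

lemma length_toPairs (X : List ℕ) : (toPairs X).length = (X.length + 1) / 2 := by
  induction X using toPairs.induct with
  | case1 => simp [toPairs]
  | case2 x => simp [toPairs]
  | case3 x y l ih => simp [toPairs, ih]; omega

lemma length_desc (s : Multiset ℕ) : (desc s).length = s.card := by
  rw [← Multiset.coe_card, coe_desc]

/-- Difference 1 makes the sum odd; difference 2 makes it 2w + 2, which is 2 mod 4 exactly for even
w. -/
lemma isSplit_iff (q : ℕ × ℕ) :
    IsSplit q ↔ (q.1 = q.2 + 1 ∨ q.1 = q.2 + 2) ∧ (q.1 + q.2) % 4 ≠ 2 := by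
  rw [IsSplit, Nat.odd_iff]
  omega

lemma mem_splitting_iff {n : ℕ} (p : n.Partition) : p ∈ splitting n ↔ IsSplitting p.parts := by
  have h0 : 0 ∉ p.parts := fun h => (p.parts_pos h).ne rfl
  have hq : (∀ q ∈ toPairs (desc p.parts), IsSplit q) ↔
      ∀ j < (toPairs (desc p.parts)).length,
        IsSplit ((toPairs (desc p.parts)).getD j (0, 0)) := by
    rw [List.forall_mem_iff_getElem]
    refine forall₂_congr fun j hj => ?_
    rw [List.getD_eq_getElem _ _ hj]
  rw [IsSplitting, and_iff_right h0, hq, length_toPairs, length_desc]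
  simp only [splitting, Nat.Partition.distincts, Finset.mem_filter, Finset.mem_univ, true_and,
    Set.mem_ofPred_eq]
  -- There are (ℓ + 1)/2 pairs, and the pair with index j, counted from 0, is the condition for j +
  -- 1.
  refine and_congr_right fun _ => ⟨fun h j hj => ?_, fun h j hj hj' => ?_⟩
  · have := h (j + 1) (by omega) (by simp only [len]; omega)
    simp only [part, Nat.add_sub_cancel,
      show 2 * (j + 1) - 1 = 2 * j + 1 by omega, getD_toPairs] at this
    exact (isSplit_iff _).2 this
  · obtain ⟨j, rfl⟩ : ∃ i, j = i + 1 := ⟨j - 1, by omega⟩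
    have := (isSplit_iff _).1 (h j (by simp only [len] at hj'; omega))
    simpa only [part, Nat.add_sub_cancel,
      show 2 * (j + 1) - 1 = 2 * j + 1 by omega, getD_toPairs] using this

lemma altSum_eq {n : ℕ} (p : n.Partition) : altSum p = (stats (toPairs (desc p.parts))).2.1 := by
  rw [stats_toPairs, length_desc, altSum, ← Finset.Ico_add_one_right_eq_Icc,
    Finset.sum_Ico_eq_sum_range]
  simp [part, len]

lemma numOddParts_eq {n : ℕ} (p : n.Partition) :
    numOddParts p = (stats (toPairs (desc p.parts))).2.2 := by
  rw [(stats_toPairs_desc p.parts).2, numOddParts, Multiset.countP_eq_card_filter]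

lemma mem_odds_iff {n : ℕ} {p : n.Partition} :
    p ∈ Nat.Partition.odds n ↔ ∀ x ∈ p.parts, Odd x := by
  simp [Nat.Partition.odds, Nat.Partition.restricted]

lemma mem_distincts_iff {n : ℕ} {p : n.Partition} :
    p ∈ Nat.Partition.distincts n ↔ p.parts.Nodup := by
  simp [Nat.Partition.distincts]

/-- A relation that is a bijection is the graph of an equivalence. -/
lemma exists_equiv_of_rel {X Y Z : Type*} (R : X → Z → Prop) (f : Y → Z)
    (hf : Function.Injective f) (hex : ∀ x, ∃ y, R x (f y))
    (huniq : ∀ x z z', R x z → R x z' → z = z') (hinj : ∀ x x' z, R x z → R x' z → x = x')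
    (hsurj : ∀ y, ∃ x, R x (f y)) : ∃ e : X ≃ Y, ∀ x z, R x z ↔ z = f (e x) := by
  choose g hg using hex
  refine ⟨Equiv.ofBijective g ⟨fun x x' h => hinj x x' _ (hg x) (h ▸ hg x'), fun y => ?_⟩, ?_⟩
  · obtain ⟨x, hx⟩ := hsurj y
    exact ⟨x, hf (huniq x _ _ (hg x) hx)⟩
  · intro x z
    exact ⟨fun h => huniq x _ _ h (hg x), fun h => h ▸ hg x⟩

/-- The partition of `n` with the given parts. -/
def partitionOf {n : ℕ} (s : Multiset ℕ) (h0 : 0 ∉ s) (hs : s.sum = n) : n.Partition :=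
  ⟨s, fun hi => Nat.pos_of_ne_zero fun h => h0 (h ▸ hi), hs⟩

lemma BressoudMap.sum_eq {β ν : Multiset ℕ} (hβ : IsOddDistinct β) (h : BressoudMap β ν) :
    ν.sum = β.sum := by
  rw [← (stats_toPairs_desc ν).1, h.stats_eq hβ]

lemma ExtendedMap.sum_eq {p μ : Multiset ℕ} (hp : ∀ x ∈ p, Odd x) (h : ExtendedMap p μ) :
    μ.sum = p.sum := by
  rw [← (stats_toPairs_desc μ).1, h.stats_eq hp]

lemma exists_bressoud_equiv (n : ℕ) :
    ∃ B : {p : n.Partition // p ∈ Nat.Partition.odds n ∧ p ∈ Nat.Partition.distincts n} ≃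
          {p : n.Partition // p ∈ splitting n},
      ∀ p (μ : Multiset ℕ), BressoudMap p.1.parts μ ↔ μ = (B p).1.parts := by
  have hodd : ∀ p : {p : n.Partition //
      p ∈ Nat.Partition.odds n ∧ p ∈ Nat.Partition.distincts n}, IsOddDistinct p.1.parts :=
    fun p => ⟨mem_distincts_iff.1 p.2.2, mem_odds_iff.1 p.2.1⟩
  refine exists_equiv_of_rel
    (R := fun (p : {p : n.Partition //
      p ∈ Nat.Partition.odds n ∧ p ∈ Nat.Partition.distincts n}) μ => BressoudMap p.1.parts μ)
    (f := fun q : {p : n.Partition // p ∈ splitting n} => q.1.parts) ?_ ?_ ?_ ?_ ?_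
  · exact fun q q' h => Subtype.ext (Nat.Partition.ext h)
  · intro p
    obtain ⟨ν, hν⟩ := exists_bressoudMap (hodd p)
    have hs := hν.isSplitting (hodd p)
    exact ⟨⟨partitionOf ν hs.2.1 ((hν.sum_eq (hodd p)).trans p.1.parts_sum),
      (mem_splitting_iff _).2 hs⟩, hν⟩
  · exact fun p z z' h h' => h.unique (hodd p) h'
  · exact fun p p' z h h' =>
      Subtype.ext (Nat.Partition.ext (h.injective (hodd p) (hodd p') h'))
  · intro q
    obtain ⟨β, hβ, h⟩ := exists_bressoudMap_of_isSplitting ((mem_splitting_iff _).1 q.2)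
    exact ⟨⟨partitionOf β (fun h0 => by simpa using hβ.2 0 h0)
      ((h.sum_eq hβ).symm.trans q.1.parts_sum),
      mem_odds_iff.2 hβ.2, mem_distincts_iff.2 hβ.1⟩, h⟩

lemma exists_extended_equiv (n : ℕ) :
    ∃ e : {p : n.Partition // p ∈ Nat.Partition.odds n} ≃
          {p : n.Partition // p ∈ Nat.Partition.distincts n},
      ∀ p (μ : Multiset ℕ), ExtendedMap p.1.parts μ ↔ μ = (e p).1.parts := by
  have hodd : ∀ p : {p : n.Partition // p ∈ Nat.Partition.odds n}, ∀ x ∈ p.1.parts, Odd x :=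
    fun p => mem_odds_iff.1 p.2
  refine exists_equiv_of_rel
    (R := fun (p : {p : n.Partition // p ∈ Nat.Partition.odds n}) μ => ExtendedMap p.1.parts μ)
    (f := fun q : {p : n.Partition // p ∈ Nat.Partition.distincts n} => q.1.parts) ?_ ?_ ?_ ?_ ?_
  · exact fun q q' h => Subtype.ext (Nat.Partition.ext h)
  · intro p
    obtain ⟨μ, hμ⟩ := exists_extendedMap (hodd p)
    have hs := hμ.nodup (hodd p)
    exact ⟨⟨partitionOf μ hs.2 ((hμ.sum_eq (hodd p)).trans p.1.parts_sum),
      mem_distincts_iff.2 hs.1⟩, hμ⟩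
  · exact fun p z z' h h' => h.unique (hodd p) h'
  · exact fun p p' z h h' =>
      Subtype.ext (Nat.Partition.ext (h.injective (hodd p) (hodd p') h'))
  · intro q
    obtain ⟨p, hp, h⟩ := exists_extendedMap_of_nodup (mem_distincts_iff.1 q.2)
      fun h => (q.1.parts_pos h).ne rfl
    exact ⟨⟨partitionOf p (fun h0 => by simpa using hp 0 h0)
      ((h.sum_eq hp).symm.trans q.1.parts_sum), mem_odds_iff.2 hp⟩, h⟩

end OddDistinct

theorem theorem3p1 (n : ℕ) :
    ∃ (B : {p : n.Partition // p ∈ Nat.Partition.odds n ∧ p ∈ Nat.Partition.distincts n} ≃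
          {p : n.Partition // p ∈ OddDistinct.splitting n})
      (e : {p : n.Partition // p ∈ Nat.Partition.odds n} ≃
          {p : n.Partition // p ∈ Nat.Partition.distincts n}),
      -- `B` is Bressoud's bijection
      (∀ p (μ : Multiset ℕ), OddDistinct.BressoudMap p.1.parts μ ↔ μ = (B p).1.parts) ∧
      -- `e` is given by Bressoud's bijection followed by pair insertions
      (∀ p (μ : Multiset ℕ), OddDistinct.ExtendedMap p.1.parts μ ↔ μ = (e p).1.parts) ∧
      -- `e` extends `B`
      (∀ p, (e ⟨p.1, p.2.1⟩).1 = (B p).1) ∧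
      -- the alternating sum of the image is the number of parts, and the number of odd parts of
      -- the image is the number of parts occurring with odd multiplicity
      (∀ p, OddDistinct.altSum (e p).1 = (OddDistinct.len p.1 : ℤ) ∧
        OddDistinct.numOddParts (e p).1 = OddDistinct.numOddMult p.1) := by
  obtain ⟨B, hB⟩ := OddDistinct.exists_bressoud_equiv n
  obtain ⟨e, he⟩ := OddDistinct.exists_extended_equiv n
  refine ⟨B, e, hB, he, fun p => ?_, fun p => ?_⟩
  · have hp : OddDistinct.IsOddDistinct p.1.parts :=
      ⟨OddDistinct.mem_distincts_iff.1 p.2.2, OddDistinct.mem_odds_iff.1 p.2.1⟩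
    have h := ((hB p _).2 rfl).extendedMap hp
    exact Nat.Partition.ext ((he ⟨p.1, p.2.1⟩ _).1 h).symm
  · have h := ((he p _).2 rfl).stats_eq (OddDistinct.mem_odds_iff.1 p.2)
    rw [OddDistinct.altSum_eq, OddDistinct.numOddParts_eq, h]
    exact ⟨rfl, rfl⟩
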